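/- **Soundness of call-by-name reduction for the guarded lambda-calculus in the topos of trees.** *Types.* Open types are $A ::= \alpha \mid \mathbf N \mid \mathbf 1 \mid A\times A \mid \mathbf 0 \mid A+A \mid A\to A \mid \mu\alpha.A \mid \blacktriangleright A \mid \blacksquare A$, where $\mu\alpha.A$ is formed only if every occurrence of $\alpha$ in $A$ is beneath a $\blacktriangleright$, and $\blacksquare A$ only if $A$ is closed. Types are closed unless said otherwise. A type is *constant* if every occurrence of $\blacktriangleright$ in it is beneath a $\blacksquare$. *Terms.* Untyped terms, up to renaming of bound variables, are those of the $\lambda$-calculus with $\mathsf{zero},\mathsf{succ}\,t$, unit $\langle\rangle$, pairs and projections $\pi_d$, $\mathsf{abort}$, injections $\mathsf{in}_d$, $\mathsf{case}$, $\mathsf{fold},\mathsf{unfold}$, together with $\mathsf{next}\,t$, $t\circledast t$, $\mathsf{unbox}\,t$, and $\mathsf{prev}\,\sigma.t$, $\mathsf{box}\,\sigma.t$, $\mathsf{box}^+\sigma.t$, where $\sigma=[\vec x\leftarrow\vec t\,]$ is an explicit substitution whose variables $\vec x$ are bound in $t$ and are the only free variables of $t$. The substitution is omitted when it is empty. *Typing.*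 $\Gamma\vdash t:A$ is given by the usual rules of the simply typed $\lambda$-calculus with naturals, products and sums and by: $\mathsf{fold}$ and $\mathsf{unfold}$ go between $A[\mu\alpha.A/\alpha]$ and $\mu\alpha.A$; $\mathsf{next}\,t:\blacktriangleright A$ if $t:A$; $t_1\circledast t_2:\blacktriangleright B$ if $t_1:\blacktriangleright(A\to B)$ and $t_2:\blacktriangleright A$; $\mathsf{unbox}\,t:A$ if $t:\blacksquare A$; and if $\Gamma\vdash t_k:A_k$ with all $A_k$ constant, then $\Gamma\vdash\mathsf{prev}[\vec x\leftarrow\vec t\,].t:A$ if $\vec x:\vec A\vdash t:\blacktriangleright A$, $\ \Gamma\vdash\mathsf{box}[\vec x\leftarrow\vec t\,].t:\blacksquare A$ if $\vec x:\vec A\vdash t:A$, and $\Gamma\vdash\mathsf{box}^+[\vec x\leftarrow\vec t\,].t:\blacksquare B_1+\blacksquare B_2$ if $\vec x:\vec A\vdash t:B_1+B_2$. *Reduction.* The rules on closed terms are, for $d\in\{1,2\}$, $$\begin{array}{ll} \pi_d\langle t_1,t_2\rangle\mapsto t_d, & \mathsf{case}\ \mathsf{in}_d\,t\ \mathsf{of}\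 x_1.t_1;x_2.t_2\mapsto t_d[t/x_d],\\ (\lambda x.t_1)t_2\mapsto t_1[t_2/x], & \mathsf{unfold}\,\mathsf{fold}\,t\mapsto t,\\ \mathsf{prev}[\vec x\leftarrow\vec t\,].t\mapsto\mathsf{prev}\,(t[\vec t/\vec x])\ (\vec x\neq\emptyset), & \mathsf{prev}\,\mathsf{next}\,t\mapsto t,\\ \mathsf{next}\,t_1\circledast\mathsf{next}\,t_2\mapsto\mathsf{next}(t_1t_2), & \mathsf{unbox}(\mathsf{box}[\vec x\leftarrow\vec t\,].t)\mapsto t[\vec t/\vec x],\\ \mathsf{box}^+[\vec x\leftarrow\vec t\,].t\mapsto\mathsf{box}^+(t[\vec t/\vec x])\ (\vec x\neq\emptyset), & \mathsf{box}^+\mathsf{in}_d\,t\mapsto\mathsf{in}_d\,\mathsf{box}\,t. \end{array}$$ Values are $\mathsf{succ}^n\mathsf{zero}$, $\langle\rangle$, pairs, injections, abstractions, and terms $\mathsf{fold}\,t$, $\mathsf{next}\,t$, $\mathsf{box}\,\sigma.t$. Evaluation contexts are $$E::=\cdot\mid\mathsf{succ}\,E\mid\pi_dE\mid\mathsf{case}\,E\,\mathsf{of}\,x_1.t_1;x_2.t_2\mid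 E\,t\mid\mathsf{unfold}\,E\mid\mathsf{prev}\,E\mid E\circledast t\mid v\circledast E\mid\mathsf{unbox}\,E\mid\mathsf{box}^+E$$ with $v$ a value. Call-by-name reduction is $E[t]\mapsto E[u]$ for a rule $t\mapsto u$, and $\rightsquigarrow$ is its reflexive transitive closure. *Denotations.* An object $X$ of the topos of trees is a sequence of sets $X_1,X_2,\dots$ with restriction functions $X_{i+1}\to X_i$; an arrow is a family of functions commuting with restrictions. Closed types denote objects: $\mathbf N,\mathbf 1,\mathbf 0$ the constant objects on $\mathbb N$, $\{*\}$, $\emptyset$; $\times,+,\to$ products, coproducts, exponentials; $(\blacktriangleright X)_1=\{*\}$ and $(\blacktriangleright X)_{i+1}=X_i$; $\blacksquare X$ the constant object on the set $\mathrm{Hom}(1,X)$; and $\mu\alpha.A$ the unique-up-to-isomorphism $X$ with $[\![A]\!](X)\cong X$. A context denotes the product of its types, and a derivation of $\Gamma\vdash t:A$ denotes an arrow $[\![t]\!]:[\![\Gamma]\!]\to[\![A]\!]$. The standard constructs are interpreted by the cartesian closed structure and the coproducts; $\mathsf{fold},\mathsf{unfold}$ by the mutually inverse isomorphisms $[\![\mu\alpha.A]\!]\cong[\![A[\mu\alpha.A/\alpha]]\!]$;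 $\mathsf{next}$ and $\mathsf{unbox}$ by the natural transformations $X\to\blacktriangleright X$ (restriction) and $\blacksquare X\to X$ (evaluation). Further, $[\![t_1\circledast t_2]\!]_1$ is the unique map and $[\![t_1\circledast t_2]\!]_{i+1}(\gamma)=([\![t_1]\!]_{i+1}(\gamma))_i([\![t_2]\!]_{i+1}(\gamma))$. Constant types denote objects whose restrictions are bijections, so their elements may be moved between stages. With this, $[\![\mathsf{prev}[\vec x\leftarrow\vec t\,].t]\!]_i(\gamma)=[\![t]\!]_{i+1}([\![\vec t\,]\!]_i(\gamma))$ and $[\![\mathsf{box}[\vec x\leftarrow\vec t\,].t]\!]_i(\gamma)_j=[\![t]\!]_j([\![\vec t\,]\!]_i(\gamma))$; and $[\![\mathsf{box}^+[\vec x\leftarrow\vec t\,].t]\!]_i(\gamma)=[a,d]$, where $[\![t]\!]_j([\![\vec t\,]\!]_i(\gamma))=[a_j,d]$ for all $j$ (the side $d$ does not depend on $j$) and $a=(a_j)_j$. **Theorem.** Let $t,u$ be closed terms with $t\rightsquigarrow u$, and let $\vdash t:A$. Then $\vdash u:A$, and $[\![t]\!]=[\![u]\!]$ as arrows $1\to[\![A]\!]$,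 whichever derivations of $\vdash t:A$ and $\vdash u:A$ are used to compute the two sides. -/

import Mathlib

namespace GuardedLambda

noncomputable section

/-! ## The topos of trees

The stages `1, 2, 3, …` are numbered `0, 1, 2, …` here. -/

/-- An object of the topos of trees: a family of sets with restriction functions. -/
structure Tree : Type 1 where
  obj : ℕ → Type
  r : ∀ i, obj (i + 1) → obj i

/-- An arrow of the topos of trees: a family of functions commuting with the restrictions. -/
@[ext]
structure Hom (X Y : Tree) : Type where
  app : ∀ i, X.obj i → Y.obj i
  nat : ∀ i x, app i (X.r i x) = Y.r i (app (i + 1) x)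

namespace Tree

/-- The composed restriction function from stage `i` to a stage `j ≤ i`. -/
def res (X : Tree) {j i : ℕ} (h : j ≤ i) : X.obj i → X.obj j :=
  Nat.leRec (motive := fun i _ => X.obj i → X.obj j) id (fun _ _ f x => f (X.r _ x)) h

theorem res_self (X : Tree) (i : ℕ) (x : X.obj i) : X.res le_rfl x = x := by
  simp [res]

theorem res_succ (X : Tree) {j i : ℕ} (h : j ≤ i) (x : X.obj (i + 1)) :
    X.res (Nat.le_succ_of_le h) x = X.res h (X.r i x) := by
  unfold res
  rw [Nat.leRec_succ]

theorem r_res (X : Tree) {j i : ℕ} (h : j + 1 ≤ i) (x : X.obj i) :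
    X.r j (X.res h x) = X.res (Nat.le_of_succ_le h) x := by
  induction i, h using Nat.le_induction with
  | base => rw [res_self, X.res_succ le_rfl, res_self]
  | succ i h ih => rw [X.res_succ h, ih, X.res_succ (Nat.le_of_succ_le h)]

/-- The constant object on a set. -/
abbrev delta (Z : Type) : Tree := ⟨fun _ => Z, fun _ z => z⟩

/-- The terminal object. -/
abbrev one : Tree := delta PUnit

/-- Binary products. -/
abbrev prod (X Y : Tree) : Tree :=
  ⟨fun i => X.obj i × Y.obj i, fun i p => (X.r i p.1, Y.r i p.2)⟩

/-- Binary coproducts. -/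
abbrev sum (X Y : Tree) : Tree :=
  ⟨fun i => X.obj i ⊕ Y.obj i, fun i => Sum.map (X.r i) (Y.r i)⟩

/-- Finite products, used for typing contexts. -/
abbrev pi {n : ℕ} (X : Fin n → Tree) : Tree :=
  ⟨fun i => ∀ k, (X k).obj i, fun i p k => (X k).r i (p k)⟩

/-- The exponential `Y ^ X`: at stage `i`, tuples of functions `X j → Y j` for `j ≤ i` that
commute with the restrictions. -/
abbrev exp (X Y : Tree) : Tree where
  obj i := { f : ∀ j, j ≤ i → X.obj j → Y.obj j //
    ∀ j (h : j + 1 ≤ i) x,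
      f j (Nat.le_of_succ_le h) (X.r j x) = Y.r j (f (j + 1) h x) }
  r _ f := ⟨fun j h => f.1 j (Nat.le_succ_of_le h), fun j h => f.2 j (Nat.le_succ_of_le h)⟩

/-- The functor `▶` on objects: a one-point set at the first stage, then `X` shifted by one. -/
def later (X : Tree) : Tree where
  obj i := match i with
    | 0 => PUnit
    | i + 1 => X.obj i
  r i := match i with
    | 0 => fun _ => PUnit.unit
    | i + 1 => X.r i

/-- The functor `■` on objects: the constant object on the set of global elements. -/
abbrev box (X : Tree) : Tree := delta (Hom one X)

/-- A constant object: all restriction functions are bijections. -/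
def IsConst (X : Tree) : Prop := ∀ i, Function.Bijective (X.r i)

theorem IsConst.res_zero {X : Tree} (h : X.IsConst) (i : ℕ) :
    Function.Bijective (X.res (Nat.zero_le i)) := by
  induction i with
  | zero =>
    have : X.res (Nat.zero_le 0) = id := funext fun x => X.res_self 0 x
    rw [this]; exact Function.bijective_id
  | succ i ih =>
    have : X.res (Nat.zero_le (i + 1)) = X.res (Nat.zero_le i) ∘ X.r i :=
      funext fun x => X.res_succ (Nat.zero_le i) x
    rw [this]; exact ih.comp (h i)

/-- The identification of all stages of a constant object: `x` at stage `i` corresponds to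
`h.move i j x` at stage `j`; they have the same restriction to the first stage. -/
def IsConst.move {X : Tree} (h : X.IsConst) (i j : ℕ) (x : X.obj i) : X.obj j :=
  (Equiv.ofBijective _ (h.res_zero j)).symm (X.res (Nat.zero_le i) x)

theorem IsConst.res_move {X : Tree} (h : X.IsConst) (i j : ℕ) (x : X.obj i) :
    X.res (Nat.zero_le j) (h.move i j x) = X.res (Nat.zero_le i) x :=
  (Equiv.ofBijective _ (h.res_zero j)).apply_symm_apply _

theorem IsConst.r_move {X : Tree} (h : X.IsConst) (i j : ℕ) (x : X.obj i) :
    X.r j (h.move i (j + 1) x) = h.move i j x := by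
  apply (h.res_zero j).1
  rw [h.res_move, ← X.res_succ (Nat.zero_le j), h.res_move]

theorem IsConst.move_r {X : Tree} (h : X.IsConst) (i j : ℕ) (x : X.obj (i + 1)) :
    h.move i j (X.r i x) = h.move (i + 1) j x := by
  apply (h.res_zero j).1
  rw [h.res_move, h.res_move, ← X.res_succ (Nat.zero_le i)]

theorem isConst_delta (Z : Type) : (delta Z).IsConst := fun _ => Function.bijective_id

theorem IsConst.pi {n : ℕ} {X : Fin n → Tree} (h : ∀ k, (X k).IsConst) : (pi X).IsConst :=
  fun i => Function.Bijective.piMap fun k => h k i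

theorem IsConst.prod {X Y : Tree} (hX : X.IsConst) (hY : Y.IsConst) : (prod X Y).IsConst :=
  fun i => (hX i).prodMap (hY i)

theorem IsConst.sum {X Y : Tree} (hX : X.IsConst) (hY : Y.IsConst) : (sum X Y).IsConst :=
  fun i => (hX i).sumMap (hY i)

theorem IsConst.exp {X Y : Tree} (hY : Y.IsConst) : (exp X Y).IsConst := by
  intro i
  constructor
  · intro f g hfg
    have key : ∀ j (h : j ≤ i) x, f.1 j (Nat.le_succ_of_le h) x = g.1 j (Nat.le_succ_of_le h) x :=
      fun j h x => congrFun (congrFun (congrFun (congrArg Subtype.val hfg) j) h) x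
    apply Subtype.ext
    funext j h x
    rcases Nat.lt_or_ge i j with hij | hij
    · obtain rfl : j = i + 1 := le_antisymm h hij
      apply (hY i).1
      rw [← f.2 i le_rfl, ← g.2 i le_rfl]
      exact key i le_rfl _
    · exact key j hij x
  · intro f
    let e := Equiv.ofBijective _ (hY i)
    refine ⟨⟨fun j h x => if hj : j ≤ i then f.1 j hj x
      else cast (by rw [show j = i + 1 by omega])
        (e.symm (f.1 i le_rfl (X.r i (cast (by rw [show j = i + 1 by omega]) x)))), ?_⟩, ?_⟩
    · intro j h x
      dsimp only
      rcases Nat.lt_or_ge j i with hij | hij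
      · rw [dif_pos (show j ≤ i by omega), dif_pos (show j + 1 ≤ i by omega)]
        exact f.2 j hij x
      · obtain rfl : j = i := by omega
        rw [dif_pos le_rfl, dif_neg (by omega)]
        exact (e.apply_symm_apply _).symm
    · apply Subtype.ext
      funext j h x
      exact dif_pos h

end Tree

/-! ### Arrows that interpret the term formers -/

namespace Hom

/-- Finite tupling. -/
def tuple {n : ℕ} {G : Tree} {X : Fin n → Tree} (f : ∀ k, Hom G (X k)) : Hom G (Tree.pi X) where
  app i γ k := (f k).app i γ
  nat i γ := funext fun k => (f k).nat i γ

/-- Projection of a context to one of its variables. -/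
def proj {n : ℕ} (X : Fin n → Tree) (k : Fin n) : Hom (Tree.pi X) (X k) where
  app _ γ := γ k
  nat _ _ := rfl

def zero {G : Tree} : Hom G (Tree.delta ℕ) := ⟨fun _ _ => (0 : ℕ), fun _ _ => rfl⟩

def succ {G : Tree} (f : Hom G (Tree.delta ℕ)) : Hom G (Tree.delta ℕ) where
  app i γ := Nat.succ (f.app i γ)
  nat i γ := congrArg Nat.succ (f.nat i γ)

def unit {G : Tree} : Hom G Tree.one := ⟨fun _ _ => PUnit.unit, fun _ _ => rfl⟩

def pair {G X Y : Tree} (f : Hom G X) (g : Hom G Y) : Hom G (X.prod Y) where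
  app i γ := (f.app i γ, g.app i γ)
  nat i γ := Prod.ext (f.nat i γ) (g.nat i γ)

def fst {G X Y : Tree} (f : Hom G (X.prod Y)) : Hom G X where
  app i γ := (f.app i γ).1
  nat i γ := congrArg Prod.fst (f.nat i γ)

def snd {G X Y : Tree} (f : Hom G (X.prod Y)) : Hom G Y where
  app i γ := (f.app i γ).2
  nat i γ := congrArg Prod.snd (f.nat i γ)

def abort {G X : Tree} (f : Hom G (Tree.delta Empty)) : Hom G X where
  app i γ := Empty.elim (f.app i γ)
  nat i γ := Empty.elim (f.app (i + 1) γ)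

def inl {G X Y : Tree} (f : Hom G X) : Hom G (X.sum Y) where
  app i γ := Sum.inl (f.app i γ)
  nat i γ := congrArg Sum.inl (f.nat i γ)

def inr {G X Y : Tree} (f : Hom G Y) : Hom G (X.sum Y) where
  app i γ := Sum.inr (f.app i γ)
  nat i γ := congrArg Sum.inr (f.nat i γ)

/-- Case distinction, where the branches are arrows from `G × X` and `G × Y`. -/
def caseOf {G X Y Z : Tree} (f : Hom G (X.sum Y)) (g : Hom (G.prod X) Z) (h : Hom (G.prod Y) Z) :
    Hom G Z where
  app i γ := Sum.elim (fun a => g.app i (γ, a)) (fun b => h.app i (γ, b)) (f.app i γ)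
  nat i γ := by
    rw [f.nat i γ]
    cases f.app (i + 1) γ with
    | inl a => exact g.nat i (γ, a)
    | inr b => exact h.nat i (γ, b)

/-- Abstraction: `(lam f) i γ` is the tuple of functions `a ↦ f j (γ restricted to j, a)`. -/
def lam {G X Y : Tree} (f : Hom (G.prod X) Y) : Hom G (Tree.exp X Y) where
  app i γ := ⟨fun j h a => f.app j (G.res h γ, a), fun j h a => by
    refine Eq.trans ?_ (f.nat j (G.res h γ, a))
    dsimp only
    rw [G.r_res]⟩
  nat i γ := Subtype.ext <| by
    funext j h a
    change f.app j (G.res h (G.r i γ), a) = f.app j (G.res (Nat.le_succ_of_le h) γ, a)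
    rw [G.res_succ h]

def ap {G X Y : Tree} (f : Hom G (Tree.exp X Y)) (g : Hom G X) : Hom G Y where
  app i γ := (f.app i γ).1 i le_rfl (g.app i γ)
  nat i γ := by
    rw [f.nat, g.nat]
    exact (f.app (i + 1) γ).2 i le_rfl _

/-- Composition with the natural transformation from the identity to `▶`. -/
def next {G X : Tree} (f : Hom G X) : Hom G X.later where
  app i γ := match i with
    | 0 => PUnit.unit
    | i + 1 => X.r i (f.app (i + 1) γ)
  nat i γ := match i with
    | 0 => rfl
    | i + 1 => congrArg (X.r i) (f.nat (i + 1) γ)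

/-- The applicative action of `▶`. -/
def lap {G X Y : Tree} (f : Hom G (Tree.exp X Y).later) (g : Hom G X.later) :
    Hom G Y.later where
  app i := match i with
    | 0 => fun _ => PUnit.unit
    | i + 1 => fun γ =>
        ((show (Tree.exp X Y).obj i from f.app (i + 1) γ).1 i le_rfl
          (show X.obj i from g.app (i + 1) γ) : Y.obj i)
  nat i := match i with
    | 0 => fun _ => rfl
    | i + 1 => fun γ => by
      have hf := f.nat (i + 1) γ
      have hg := g.nat (i + 1) γ
      dsimp only
      rw [hf, hg]
      exact (show (Tree.exp X Y).obj (i + 1) from f.app (i + 2) γ).2 i le_rfl _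

/-- The interpretation of `prev`: the body is evaluated one stage later, at the values of the
explicit substitution, which live in a constant object. -/
def prev {G D X : Tree} (hD : D.IsConst) (f : Hom D X.later) (s : Hom G D) : Hom G X where
  app i γ := f.app (i + 1) (hD.move i (i + 1) (s.app i γ))
  nat i γ := by
    change _ = X.later.r (i + 1) _
    rw [← f.nat (i + 1), hD.r_move, s.nat, hD.move_r]

/-- The interpretation of `box`: the body is evaluated at all stages, at the values of the
explicit substitution, which live in a constant object. -/
def box {G D X : Tree} (hD : D.IsConst) (f : Hom D X) (s : Hom G D) : Hom G X.box where
  app i γ := ⟨fun j _ => f.app j (hD.move i j (s.app i γ)), fun j _ => by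
    rw [← f.nat j, hD.r_move]⟩
  nat i γ := Hom.ext <| by
    funext j _
    change f.app j _ = f.app j _
    rw [s.nat, hD.move_r]

/-- Composition with the natural transformation from `■` to the identity. -/
def unbox {G X : Tree} (f : Hom G X.box) : Hom G X where
  app i γ := (show Hom Tree.one X from f.app i γ).app i PUnit.unit
  nat i γ := by
    rw [f.nat i γ]
    exact (show Hom Tree.one X from f.app (i + 1) γ).nat i PUnit.unit

theorem isLeft_global {X Y : Tree} (s : Hom Tree.one (X.sum Y)) (j : ℕ) :
    (s.app j PUnit.unit : X.obj j ⊕ Y.obj j).isLeft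
      = (s.app 0 PUnit.unit : X.obj 0 ⊕ Y.obj 0).isLeft := by
  induction j with
  | zero => rfl
  | succ j ih =>
    rw [← ih]
    have h : s.app j PUnit.unit = Sum.map (X.r j) (Y.r j) (s.app (j + 1) PUnit.unit) :=
      s.nat j PUnit.unit
    rw [h, Sum.isLeft_map]

/-- A global element of a coproduct is on the same side at all stages, so it gives a global
element of one of the two summands. -/
def split {X Y : Tree} (s : Hom Tree.one (X.sum Y)) : Hom Tree.one X ⊕ Hom Tree.one Y :=
  if h : (s.app 0 PUnit.unit : X.obj 0 ⊕ Y.obj 0).isLeft = true then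
    Sum.inl ⟨fun j _ => Sum.getLeft (s.app j PUnit.unit : X.obj j ⊕ Y.obj j)
        ((isLeft_global s j).trans h), fun j _ => by
      apply Sum.inl_injective (β := Y.obj j)
      rw [Sum.inl_getLeft]
      refine (s.nat j PUnit.unit).trans ?_
      change Sum.map (X.r j) (Y.r j) (s.app (j + 1) PUnit.unit) = _
      rw [← Sum.map_inl (f := X.r j) (g := Y.r j), Sum.inl_getLeft]⟩
  else
    Sum.inr ⟨fun j _ => Sum.getRight (s.app j PUnit.unit : X.obj j ⊕ Y.obj j)
        (Sum.not_isLeft.mp (by rw [isLeft_global s j]; exact h)), fun j _ => by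
      apply Sum.inr_injective (α := X.obj j)
      rw [Sum.inr_getRight]
      refine (s.nat j PUnit.unit).trans ?_
      change Sum.map (X.r j) (Y.r j) (s.app (j + 1) PUnit.unit) = _
      rw [← Sum.map_inr (f := X.r j) (g := Y.r j), Sum.inr_getRight]⟩

/-- The interpretation of `box⁺`. -/
def boxPlus {G D X Y : Tree} (hD : D.IsConst) (f : Hom D (X.sum Y)) (s : Hom G D) :
    Hom G (X.box.sum Y.box) where
  app i γ := split ((box hD f s).app i γ)
  nat i γ := by
    rw [(box hD f s).nat i γ]
    change split ((box hD f s).app (i + 1) γ) = Sum.map id id _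
    rw [Sum.map_id_id]; rfl

/-- Composition of arrows. -/
def comp {X Y Z : Tree} (f : Hom X Y) (g : Hom Y Z) : Hom X Z where
  app i x := g.app i (f.app i x)
  nat i x := by rw [f.nat, g.nat]

end Hom

/-! ## Types -/

/-- Open types with `n` free type variables (de Bruijn indices; `mu` binds the index `0`).
The type former `■` applies to closed types only. -/
inductive Ty : ℕ → Type
  | var {n : ℕ} (i : Fin n) : Ty n
  | nat {n : ℕ} : Ty n
  | one {n : ℕ} : Ty n
  | prod {n : ℕ} (A B : Ty n) : Ty n
  | zero {n : ℕ} : Ty n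
  | sum {n : ℕ} (A B : Ty n) : Ty n
  | arr {n : ℕ} (A B : Ty n) : Ty n
  | mu {n : ℕ} (A : Ty (n + 1)) : Ty n
  | later {n : ℕ} (A : Ty n) : Ty n
  | box {n : ℕ} (A : Ty 0) : Ty n

namespace Ty

/-- The variable `i` is guarded in a type: all its occurrences are beneath a `▶`. -/
def Guarded : {n : ℕ} → Fin n → Ty n → Prop
  | _, i, var j => j ≠ i
  | _, _, nat => True
  | _, _, one => True
  | _, i, prod A B => A.Guarded i ∧ B.Guarded i
  | _, _, zero => True
  | _, i, sum A B => A.Guarded i ∧ B.Guarded i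
  | _, i, arr A B => A.Guarded i ∧ B.Guarded i
  | _, i, mu A => A.Guarded i.succ
  | _, _, later _ => True
  | _, _, box _ => True

/-- Type formation: `μ α. A` is formed only if `α` is guarded in `A`. -/
def WF : {n : ℕ} → Ty n → Prop
  | _, var _ => True
  | _, nat => True
  | _, one => True
  | _, prod A B => A.WF ∧ B.WF
  | _, zero => True
  | _, sum A B => A.WF ∧ B.WF
  | _, arr A B => A.WF ∧ B.WF
  | _, mu A => A.WF ∧ A.Guarded 0
  | _, later A => A.WF
  | _, box A => A.WF

/-- A type is constant if all occurrences of `▶` are beneath a `■`. -/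
def Constant : {n : ℕ} → Ty n → Prop
  | _, var _ => True
  | _, nat => True
  | _, one => True
  | _, prod A B => A.Constant ∧ B.Constant
  | _, zero => True
  | _, sum A B => A.Constant ∧ B.Constant
  | _, arr A B => A.Constant ∧ B.Constant
  | _, mu A => A.Constant
  | _, later _ => False
  | _, box _ => True

/-- Renaming of type variables. -/
def ren : {n m : ℕ} → (Fin n → Fin m) → Ty n → Ty m
  | _, _, ξ, var i => var (ξ i)
  | _, _, _, nat => nat
  | _, _, _, one => one
  | _, _, ξ, prod A B => prod (A.ren ξ) (B.ren ξ)
  | _, _, _, zero => zero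
  | _, _, ξ, sum A B => sum (A.ren ξ) (B.ren ξ)
  | _, _, ξ, arr A B => arr (A.ren ξ) (B.ren ξ)
  | _, _, ξ, mu A => mu (A.ren (Fin.cases 0 fun i => (ξ i).succ))
  | _, _, ξ, later A => later (A.ren ξ)
  | _, _, _, box A => box A

/-- Simultaneous substitution for type variables. -/
def subst : {n m : ℕ} → (Fin n → Ty m) → Ty n → Ty m
  | _, _, σ, var i => σ i
  | _, _, _, nat => nat
  | _, _, _, one => one
  | _, _, σ, prod A B => prod (A.subst σ) (B.subst σ)
  | _, _, _, zero => zero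
  | _, _, σ, sum A B => sum (A.subst σ) (B.subst σ)
  | _, _, σ, arr A B => arr (A.subst σ) (B.subst σ)
  | _, _, σ, mu A => mu (A.subst (Fin.cases (var 0) fun i => (σ i).ren Fin.succ))
  | _, _, σ, later A => later (A.subst σ)
  | _, _, _, box A => box A

/-- The unfolding `A[μ α. A / α]` of a closed recursive type. -/
def unfolding (A : Ty 1) : Ty 0 := A.subst fun _ => mu A

theorem guarded_ren {n : ℕ} (A : Ty n) : ∀ {m : ℕ} (ξ : Fin n → Fin m) (j : Fin m),
    (∀ i, ξ i = j → A.Guarded i) → (A.ren ξ).Guarded j := by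
  induction A with
  | var i => intro m ξ j h hi; exact h i hi rfl
  | nat => intros; trivial
  | one => intros; trivial
  | zero => intros; trivial
  | later => intros; trivial
  | box => intros; trivial
  | prod A B ihA ihB =>
    intro m ξ j h; exact ⟨ihA ξ j fun i hi => (h i hi).1, ihB ξ j fun i hi => (h i hi).2⟩
  | sum A B ihA ihB =>
    intro m ξ j h; exact ⟨ihA ξ j fun i hi => (h i hi).1, ihB ξ j fun i hi => (h i hi).2⟩
  | arr A B ihA ihB =>
    intro m ξ j h; exact ⟨ihA ξ j fun i hi => (h i hi).1, ihB ξ j fun i hi => (h i hi).2⟩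
  | mu A ih =>
    intro m ξ j h
    refine ih _ _ fun i => ?_
    refine Fin.cases (fun hi => absurd hi (Fin.succ_ne_zero j).symm) (fun i hi => ?_) i
    exact h i (Fin.succ_injective _ hi)

theorem guarded_subst {n : ℕ} (A : Ty n) : ∀ {m : ℕ} (σ : Fin n → Ty m) (j : Fin m),
    (∀ i, (σ i).Guarded j ∨ A.Guarded i) → (A.subst σ).Guarded j := by
  induction A with
  | var i => intro m σ j h; exact (h i).resolve_right fun hi => hi rfl
  | nat => intros; trivial
  | one => intros; trivial
  | zero => intros; trivial
  | later => intros; trivial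
  | box => intros; trivial
  | prod A B ihA ihB =>
    intro m σ j h
    exact ⟨ihA σ j fun i => (h i).imp_right And.left, ihB σ j fun i => (h i).imp_right And.right⟩
  | sum A B ihA ihB =>
    intro m σ j h
    exact ⟨ihA σ j fun i => (h i).imp_right And.left, ihB σ j fun i => (h i).imp_right And.right⟩
  | arr A B ihA ihB =>
    intro m σ j h
    exact ⟨ihA σ j fun i => (h i).imp_right And.left, ihB σ j fun i => (h i).imp_right And.right⟩
  | mu A ih =>
    intro m σ j h
    refine ih _ _ fun i => ?_
    refine Fin.cases (Or.inl (Fin.succ_ne_zero j).symm) (fun i => ?_) i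
    refine (h i).imp_left fun hi => guarded_ren _ _ _ fun k hk => ?_
    rwa [Fin.succ_injective _ hk]

theorem wf_ren {n : ℕ} (A : Ty n) : ∀ {m : ℕ} (ξ : Fin n → Fin m), A.WF → (A.ren ξ).WF := by
  induction A with
  | var i => intros; trivial
  | nat => intros; trivial
  | one => intros; trivial
  | zero => intros; trivial
  | later A ih => intro m ξ h; exact ih ξ h
  | box A => intro m ξ h; exact h
  | prod A B ihA ihB => intro m ξ h; exact ⟨ihA ξ h.1, ihB ξ h.2⟩
  | sum A B ihA ihB => intro m ξ h; exact ⟨ihA ξ h.1, ihB ξ h.2⟩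
  | arr A B ihA ihB => intro m ξ h; exact ⟨ihA ξ h.1, ihB ξ h.2⟩
  | mu A ih =>
    intro m ξ h
    refine ⟨ih _ h.1, guarded_ren _ _ _ fun i => ?_⟩
    exact Fin.cases (fun _ => h.2) (fun i hi => absurd hi (Fin.succ_ne_zero _)) i

theorem wf_subst {n : ℕ} (A : Ty n) : ∀ {m : ℕ} (σ : Fin n → Ty m), A.WF → (∀ i, (σ i).WF) →
    (A.subst σ).WF := by
  induction A with
  | var i => intro m σ _ h; exact h i
  | nat => intros; trivial
  | one => intros; trivial
  | zero => intros; trivial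
  | later A ih => intro m σ h hσ; exact ih σ h hσ
  | box A => intro m σ h _; exact h
  | prod A B ihA ihB => intro m σ h hσ; exact ⟨ihA σ h.1 hσ, ihB σ h.2 hσ⟩
  | sum A B ihA ihB => intro m σ h hσ; exact ⟨ihA σ h.1 hσ, ihB σ h.2 hσ⟩
  | arr A B ihA ihB => intro m σ h hσ; exact ⟨ihA σ h.1 hσ, ihB σ h.2 hσ⟩
  | mu A ih =>
    intro m σ h hσ
    refine ⟨ih _ h.1 fun i => Fin.cases trivial (fun i => wf_ren _ _ (hσ i)) i,
      guarded_subst _ _ _ fun i => ?_⟩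
    refine Fin.cases (Or.inr h.2) (fun i => Or.inl ?_) i
    exact guarded_ren _ _ _ fun k hk => absurd hk (Fin.succ_ne_zero k)

theorem wf_unfolding {A : Ty 1} (h : (mu A : Ty 0).WF) : A.unfolding.WF :=
  wf_subst A _ h.1 fun _ => h

end Ty

/-! ## The interpretation of types

An open type is interpreted as an operation on objects of the topos of trees, together with its
action on isomorphisms. This is the diagonal `W ↦ F (W, W)` of the mixed-variance interpretation:
the interpretations of closed types only ever evaluate a mixed-variance functor with the same object
in the negative and the positive positions, and the fixed point that interprets `μ α. A` is the
object `X` with `F (X, X) ≅ X`. The action on isomorphisms is recorded stage by stage: isomorphisms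
between the arguments that are given only at certain stages induce an isomorphism between the
results at certain stages. This is local contractiveness in the guarded variables, which is what the
construction of the fixed points needs. -/

/-- An isomorphism of objects that is defined only at the stages in `U`. -/
structure PIso (U : ℕ → Prop) (X Y : Tree) : Type where
  eqv : ∀ j, U j → X.obj j ≃ Y.obj j
  nat : ∀ j (h : U j) (h' : U (j + 1)) x, eqv j h (X.r j x) = Y.r j (eqv (j + 1) h' x)

namespace PIso

def refl (U : ℕ → Prop) (X : Tree) : PIso U X X := ⟨fun _ _ => Equiv.refl _, fun _ _ _ _ => rfl⟩

def trans {U : ℕ → Prop} {X Y Z : Tree} (e : PIso U X Y) (e' : PIso U Y Z) : PIso U X Z where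
  eqv j h := (e.eqv j h).trans (e'.eqv j h)
  nat j h h' x := by simp [e.nat j h h', e'.nat j h h']

def trunc {U V : ℕ → Prop} {X Y : Tree} (h : ∀ j, V j → U j) (e : PIso U X Y) : PIso V X Y where
  eqv j hj := e.eqv j (h j hj)
  nat j hj hj' x := e.nat j (h j hj) (h (j + 1) hj') x

theorem symm_nat {U : ℕ → Prop} {X Y : Tree} (e : PIso U X Y) (j : ℕ) (h : U j) (h' : U (j + 1))
    (y : Y.obj (j + 1)) : (e.eqv j h).symm (Y.r j y) = X.r j ((e.eqv (j + 1) h').symm y) := by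
  rw [Equiv.symm_apply_eq, e.nat j h h', Equiv.apply_symm_apply]

/-- An isomorphism defined at all stages, as an arrow. -/
def hom {U : ℕ → Prop} {X Y : Tree} (hU : ∀ j, U j) (e : PIso U X Y) : Hom X Y where
  app j x := e.eqv j (hU j) x
  nat j x := e.nat j (hU j) (hU (j + 1)) x

/-- The inverse of an isomorphism defined at all stages, as an arrow. -/
def inv {U : ℕ → Prop} {X Y : Tree} (hU : ∀ j, U j) (e : PIso U X Y) : Hom Y X where
  app j y := (e.eqv j (hU j)).symm y
  nat j y := e.symm_nat j (hU j) (hU (j + 1)) y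

end PIso

abbrev Env (n : ℕ) : Type 1 := Fin n → Tree

abbrev Lev (n : ℕ) : Type := Fin n → ℕ → Prop

abbrev EIso {n : ℕ} (L : Lev n) (ρ ρ' : Env n) : Type := ∀ i, PIso (L i) (ρ i) (ρ' i)

abbrev EIso.trans {n : ℕ} {L : Lev n} {ρ ρ' ρ'' : Env n} (e : EIso L ρ ρ') (e' : EIso L ρ' ρ'') :
    EIso L ρ ρ'' := fun i => (e i).trans (e' i)

abbrev Env.cons {n : ℕ} (X : Tree) (ρ : Env n) : Env (n + 1) := Fin.cons (α := fun _ => Tree) X ρ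

abbrev Lev.cons {n : ℕ} (U : ℕ → Prop) (L : Lev n) : Lev (n + 1) :=
  Fin.cons (α := fun _ => ℕ → Prop) U L

def EIso.cons {n : ℕ} {U : ℕ → Prop} {L : Lev n} {X Y : Tree} {ρ ρ' : Env n} (e : PIso U X Y)
    (es : EIso L ρ ρ') : EIso (Lev.cons U L) (Env.cons X ρ) (Env.cons Y ρ') :=
  Fin.cases e es

theorem EIso.cons_trans {n : ℕ} {U : ℕ → Prop} {L : Lev n} {X Y Z : Tree} {ρ ρ' ρ'' : Env n}
    (e : PIso U X Y) (es : EIso L ρ ρ') (e' : PIso U Y Z) (es' : EIso L ρ' ρ'') :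
    EIso.trans (EIso.cons e es) (EIso.cons e' es') = EIso.cons (e.trans e') (es.trans es') := by
  funext i
  exact Fin.cases rfl (fun _ => rfl) i

/-- The interpretation of an open type with `n` free variables. Given isomorphisms between the
arguments, the `i`-th of which is defined at the stages in `L i`, the functor gives an isomorphism
between the results, defined at the stages in `dom L`. -/
@[ext]
structure TyFun (n : ℕ) : Type 1 where
  obj : Env n → Tree
  dom : Lev n → ℕ → Prop
  map : ∀ {L : Lev n} {ρ ρ' : Env n}, EIso L ρ ρ' → PIso (dom L) (obj ρ) (obj ρ')
  dom_mono : ∀ {L L' : Lev n} {j : ℕ}, (∀ i j', j' ≤ j → L i j' → L' i j') → dom L j → dom L' j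
  dom_top : ∀ {L : Lev n}, (∀ i j, L i j) → ∀ j, dom L j
  map_trans : ∀ {L : Lev n} {ρ ρ' ρ'' : Env n} (e : EIso L ρ ρ') (e' : EIso L ρ' ρ'') j
    (h : dom L j) x, (map (e.trans e')).eqv j h x = (map e').eqv j h ((map e).eqv j h x)
  map_congr : ∀ {L L' : Lev n} {ρ ρ' : Env n} (e : EIso L ρ ρ') (e' : EIso L' ρ ρ') j
    (h : dom L j) (h' : dom L' j),
    (∀ i j', j' ≤ j → ∀ (hL : L i j') (hL' : L' i j'), (e i).eqv j' hL = (e' i).eqv j' hL') →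
    (map e).eqv j h = (map e').eqv j h'

namespace TyFun

/-- Contractiveness in the variable `i`: the functor determines an isomorphism at stage `j` from
isomorphisms of the `i`-th argument at the stages strictly below `j`. -/
def Ctr {n : ℕ} (F : TyFun n) (i : Fin n) : Prop :=
  ∀ (L L' : Lev n) (j : ℕ), (∀ i', i' ≠ i → ∀ j', j' ≤ j → L i' j' → L' i' j') →
    (∀ j', j' < j → L' i j') → F.dom L j → F.dom L' j

/-- Compatibility of the action with composites of isomorphisms given at different stages. -/
theorem map_comp {n : ℕ} (F : TyFun n) {L₁ L₂ L₃ M : Lev n} {ρ ρ' ρ'' : Env n}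
    (e₁ : EIso L₁ ρ ρ') (e₂ : EIso L₂ ρ' ρ'') (e₃ : EIso L₃ ρ ρ'')
    (h₁ : ∀ i j, M i j → L₁ i j) (h₂ : ∀ i j, M i j → L₂ i j) (j : ℕ) (d : F.dom M j)
    (d₁ : F.dom L₁ j) (d₂ : F.dom L₂ j) (d₃ : F.dom L₃ j)
    (h : ∀ i j', j' ≤ j → ∀ (hM : M i j') (hL : L₃ i j') x,
      (e₃ i).eqv j' hL x
        = (e₂ i).eqv j' (h₂ i j' hM) ((e₁ i).eqv j' (h₁ i j' hM) x)) (x : (F.obj ρ).obj j) :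
    (F.map e₃).eqv j d₃ x = (F.map e₂).eqv j d₂ ((F.map e₁).eqv j d₁ x) := by
  let e₁' : EIso M ρ ρ' := fun i => (e₁ i).trunc (h₁ i)
  let e₂' : EIso M ρ' ρ'' := fun i => (e₂ i).trunc (h₂ i)
  rw [F.map_congr e₁ e₁' j d₁ d fun _ _ _ _ _ => rfl,
    F.map_congr e₂ e₂' j d₂ d fun _ _ _ _ _ => rfl, ← F.map_trans,
    F.map_congr e₃ (e₁'.trans e₂') j d₃ d]
  intro i j' hj' hL hM
  exact Equiv.ext fun x => h i j' hj' hM hL x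

def var {n : ℕ} (i : Fin n) : TyFun n where
  obj ρ := ρ i
  dom L := L i
  map e := e i
  dom_mono h d := h i _ le_rfl d
  dom_top h := h i
  map_trans _ _ _ _ _ := rfl
  map_congr _ _ j h h' H := H i j le_rfl h h'

def const {n : ℕ} (X : Tree) : TyFun n where
  obj _ := X
  dom _ _ := True
  map _ := PIso.refl _ _
  dom_mono _ _ := trivial
  dom_top _ _ := trivial
  map_trans _ _ _ _ _ := rfl
  map_congr _ _ _ _ _ _ := rfl

def prod {n : ℕ} (F G : TyFun n) : TyFun n where
  obj ρ := (F.obj ρ).prod (G.obj ρ)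
  dom L j := F.dom L j ∧ G.dom L j
  map e := ⟨fun j h => Equiv.prodCongr ((F.map e).eqv j h.1) ((G.map e).eqv j h.2),
    fun j h h' x => Prod.ext ((F.map e).nat j h.1 h'.1 x.1) ((G.map e).nat j h.2 h'.2 x.2)⟩
  dom_mono h d := ⟨F.dom_mono h d.1, G.dom_mono h d.2⟩
  dom_top h j := ⟨F.dom_top h j, G.dom_top h j⟩
  map_trans e e' j h x := Prod.ext (F.map_trans e e' j h.1 x.1) (G.map_trans e e' j h.2 x.2)
  map_congr e e' j h h' H := by
    dsimp only
    rw [F.map_congr e e' j h.1 h'.1 H, G.map_congr e e' j h.2 h'.2 H]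

def sum {n : ℕ} (F G : TyFun n) : TyFun n where
  obj ρ := (F.obj ρ).sum (G.obj ρ)
  dom L j := F.dom L j ∧ G.dom L j
  map e := ⟨fun j h => Equiv.sumCongr ((F.map e).eqv j h.1) ((G.map e).eqv j h.2),
    fun j h h' x => match x with
      | Sum.inl x => congrArg Sum.inl ((F.map e).nat j h.1 h'.1 x)
      | Sum.inr x => congrArg Sum.inr ((G.map e).nat j h.2 h'.2 x)⟩
  dom_mono h d := ⟨F.dom_mono h d.1, G.dom_mono h d.2⟩
  dom_top h j := ⟨F.dom_top h j, G.dom_top h j⟩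
  map_trans e e' j h x := match x with
    | Sum.inl x => congrArg Sum.inl (F.map_trans e e' j h.1 x)
    | Sum.inr x => congrArg Sum.inr (G.map_trans e e' j h.2 x)
  map_congr e e' j h h' H := by
    dsimp only
    rw [F.map_congr e e' j h.1 h'.1 H, G.map_congr e e' j h.2 h'.2 H]

/-- Exponentials act by conjugation. -/
def expEquiv {X X' Y Y' : Tree} {U V : ℕ → Prop} (e : PIso U X X') (e' : PIso V Y Y') (j : ℕ)
    (h : ∀ j', j' ≤ j → U j' ∧ V j') : (X.exp Y).obj j ≃ (X'.exp Y').obj j where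
  toFun f := ⟨fun j' hj x => e'.eqv j' (h j' hj).2 (f.1 j' hj ((e.eqv j' (h j' hj).1).symm x)),
    fun j' hj x => by
      rw [← e'.nat j' (h j' (Nat.le_of_succ_le hj)).2, ← f.2 j' hj,
        ← e.symm_nat j' (h j' (Nat.le_of_succ_le hj)).1]⟩
  invFun f := ⟨fun j' hj x => (e'.eqv j' (h j' hj).2).symm (f.1 j' hj (e.eqv j' (h j' hj).1 x)),
    fun j' hj x => by
      rw [← e'.symm_nat j' (h j' (Nat.le_of_succ_le hj)).2, ← f.2 j' hj,
        ← e.nat j' (h j' (Nat.le_of_succ_le hj)).1]⟩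
  left_inv f := Subtype.ext <| by funext j' hj x; simp
  right_inv f := Subtype.ext <| by funext j' hj x; simp

def exp {n : ℕ} (F G : TyFun n) : TyFun n where
  obj ρ := (F.obj ρ).exp (G.obj ρ)
  dom L j := ∀ j', j' ≤ j → F.dom L j' ∧ G.dom L j'
  map e := ⟨fun j h => expEquiv (F.map e) (G.map e) j h, fun _ _ _ _ => rfl⟩
  dom_mono h d j' hj := ⟨F.dom_mono (fun i k hk => h i k (hk.trans hj)) (d j' hj).1,
    G.dom_mono (fun i k hk => h i k (hk.trans hj)) (d j' hj).2⟩
  dom_top h j j' _ := ⟨F.dom_top h j', G.dom_top h j'⟩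
  map_trans e e' j h f := Subtype.ext <| by
    funext j' hj x
    have hs : ((F.map (e.trans e')).eqv j' (h j' hj).1).symm x
        = ((F.map e).eqv j' (h j' hj).1).symm (((F.map e').eqv j' (h j' hj).1).symm x) := by
      rw [Equiv.symm_apply_eq, F.map_trans, Equiv.apply_symm_apply, Equiv.apply_symm_apply]
    change (G.map (e.trans e')).eqv j' _ (f.1 j' hj _) = _
    rw [G.map_trans, hs]
    rfl
  map_congr e e' j h h' H := Equiv.ext fun f => Subtype.ext <| by
    funext j' hj x
    change (G.map e).eqv j' _ (f.1 j' hj _) = (G.map e').eqv j' _ (f.1 j' hj _)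
    rw [F.map_congr e e' j' (h j' hj).1 (h' j' hj).1 fun i k hk => H i k (hk.trans hj),
      G.map_congr e e' j' (h j' hj).2 (h' j' hj).2 fun i k hk => H i k (hk.trans hj)]

def laterDom (U : ℕ → Prop) : ℕ → Prop
  | 0 => True
  | j + 1 => U j

def laterEquiv {X Y : Tree} {U : ℕ → Prop} (e : PIso U X Y) :
    ∀ j, laterDom U j → X.later.obj j ≃ Y.later.obj j
  | 0, _ => Equiv.refl _
  | j + 1, h => e.eqv j h

def later {n : ℕ} (F : TyFun n) : TyFun n where
  obj ρ := (F.obj ρ).later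
  dom L := laterDom (F.dom L)
  map e := ⟨laterEquiv (F.map e), fun j => match j with
    | 0 => fun _ _ _ => rfl
    | j + 1 => fun h h' x => (F.map e).nat j h h' x⟩
  dom_mono {_ _ j} h := match j, h with
    | 0, _ => fun _ => trivial
    | _ + 1, h => fun d => F.dom_mono (fun i k hk => h i k (Nat.le_succ_of_le hk)) d
  dom_top h j := match j with
    | 0 => trivial
    | j + 1 => F.dom_top h j
  map_trans e e' j := match j with
    | 0 => fun _ _ => rfl
    | j + 1 => fun h x => F.map_trans e e' j h x
  map_congr e e' j := match j with
    | 0 => fun _ _ _ => rfl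
    | j + 1 => fun h h' H => F.map_congr e e' j h h' fun i k hk => H i k (Nat.le_succ_of_le hk)

/-! ### Fixed points of contractive functors -/

section Fix

variable {n : ℕ} (F : TyFun (n + 1))

/-- The finite approximations of the fixed point, starting from the terminal object. -/
def approx (ρ : Env n) (k : ℕ) : Tree :=
  Nat.rec Tree.one (fun _ X => F.obj (Env.cons X ρ)) k

abbrev ltLev (n k : ℕ) : Lev (n + 1) := Lev.cons (fun j => j < k) fun _ _ => True

theorem dom_lt (hF : F.Ctr 0) {k j : ℕ} (h : j ≤ k) : F.dom (ltLev n k) j := by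
  refine hF (fun _ _ => True) _ j ?_ (fun j' hj' => ?_) (F.dom_top (fun _ _ => trivial) j)
  · intro i
    exact Fin.cases (fun h => absurd rfl h) (fun _ _ _ _ _ => trivial) i
  · exact lt_of_lt_of_le hj' h

/-- Consecutive approximations agree at more and more stages. -/
def step (hF : F.Ctr 0) (ρ : Env n) : ∀ k, PIso (fun j => j < k) (approx F ρ k) (approx F ρ (k + 1))
  | 0 => ⟨fun j h => absurd h (Nat.not_lt_zero j), fun j h => absurd h (Nat.not_lt_zero j)⟩
  | k + 1 => (F.map (EIso.cons (step hF ρ k) fun i => PIso.refl (fun _ => True) (ρ i))).trunc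
      fun _ hj => dom_lt F hF (Nat.le_of_lt_succ hj)

/-- The fixed point: its set at stage `i` is that of any sufficiently late approximation. -/
def fixObj (hF : F.Ctr 0) (ρ : Env n) : Tree where
  obj i := (approx F ρ (i + 1)).obj i
  r i x := ((step F hF ρ (i + 1)).eqv i (Nat.lt_succ_self i)).symm ((approx F ρ (i + 2)).r i x)

def up (hF : F.Ctr 0) (ρ : Env n) (j : ℕ) {k : ℕ} (h : j + 1 ≤ k) :
    (approx F ρ (j + 1)).obj j ≃ (approx F ρ k).obj j :=
  Nat.leRec (motive := fun k _ => (approx F ρ (j + 1)).obj j ≃ (approx F ρ k).obj j)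
    (Equiv.refl _) (fun k hk e => e.trans ((step F hF ρ k).eqv j hk)) h

theorem up_self (hF : F.Ctr 0) (ρ : Env n) (j : ℕ) : up F hF ρ j le_rfl = Equiv.refl _ := by
  simp [up]

theorem up_succ (hF : F.Ctr 0) (ρ : Env n) (j : ℕ) {k : ℕ} (h : j + 1 ≤ k) :
    up F hF ρ j (Nat.le_succ_of_le h) = (up F hF ρ j h).trans ((step F hF ρ k).eqv j h) := by
  unfold up
  rw [Nat.leRec_succ]

theorem up_nat (hF : F.Ctr 0) (ρ : Env n) (j : ℕ) {k : ℕ} (h : j + 2 ≤ k) (x : (approx F ρ (j + 2)).obj (j + 1)) :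
    up F hF ρ j (Nat.le_of_succ_le h) ((fixObj F hF ρ).r j x)
      = (approx F ρ k).r j (up F hF ρ (j + 1) h x) := by
  induction k, h using Nat.le_induction with
  | base =>
    rw [up_self, up_succ F hF ρ j le_rfl, up_self]
    exact Equiv.apply_symm_apply _ _
  | succ k h ih =>
    rw [up_succ F hF ρ j (Nat.le_of_succ_le h), up_succ F hF ρ (j + 1) h]
    refine (congrArg ((step F hF ρ k).eqv j _) ih).trans ?_
    exact (step F hF ρ k).nat j _ h _

/-- The fixed point agrees with the `k`-th approximation at the first `k` stages. -/
def cmp (hF : F.Ctr 0) (ρ : Env n) (k : ℕ) : PIso (fun j => j < k) (fixObj F hF ρ) (approx F ρ k) where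
  eqv j h := up F hF ρ j h
  nat j _ h' x := up_nat F hF ρ j h' x

/-- The defining isomorphism of the fixed point. -/
def foldIso (hF : F.Ctr 0) (ρ : Env n) :
    PIso (fun _ => True) (F.obj (Env.cons (fixObj F hF ρ) ρ)) (fixObj F hF ρ) where
  eqv j _ := (F.map (EIso.cons (cmp F hF ρ j) fun i => PIso.refl (fun _ => True) (ρ i))).eqv j
    (dom_lt F hF le_rfl)
  nat j _ _ x := by
    let c (k : ℕ) := EIso.cons (cmp F hF ρ k) fun i => PIso.refl (fun _ => True) (ρ i)
    have h1 : j + 1 < j + 2 := Nat.lt_succ_self _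
    refine ((Equiv.symm_apply_eq _).mpr ?_).symm
    refine ((F.map (c (j + 1))).nat j (dom_lt F hF (Nat.le_succ j)) (dom_lt F hF le_rfl) x).symm.trans
      ?_
    refine F.map_comp (M := ltLev n j) (c j)
      (EIso.cons (step F hF ρ j) fun i => PIso.refl (fun _ => True) (ρ i)) (c (j + 1))
      (fun _ _ h => h) (fun _ _ h => h) j (dom_lt F hF le_rfl) (dom_lt F hF le_rfl)
      (dom_lt F hF le_rfl) (dom_lt F hF (Nat.le_succ j)) ?_ _
    intro i j' _
    refine Fin.cases (fun hM hL y => ?_) (fun i hM hL y => rfl) i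
    exact congrFun (congrArg _ (up_succ F hF ρ j' hM)) y

/-- The stages at which the action of the fixed point is defined. -/
def fixDom (L : Lev n) (j : ℕ) : Prop := ∀ j', j' ≤ j → F.dom (Lev.cons (fun _ => True) L) j'

abbrev fixLev (L : Lev n) (k : ℕ) : Lev (n + 1) := Lev.cons (fun j => fixDom F L j ∧ j < k) L

theorem dom_fixLev (hF : F.Ctr 0) {L : Lev n} {k j : ℕ} (h : fixDom F L j) (hj : j ≤ k) :
    F.dom (fixLev F L k) j := by
  refine hF (Lev.cons (fun _ => True) L) _ j ?_ (fun j' hj' => ?_) (h j le_rfl)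
  · intro i
    exact Fin.cases (fun h => absurd rfl h) (fun _ _ _ _ h => h) i
  · exact ⟨fun j'' h' => h j'' (h'.trans hj'.le), lt_of_lt_of_le hj' hj⟩

variable {L : Lev n} {ρ ρ' : Env n}

/-- The action on the approximations. -/
def approxMap (hF : F.Ctr 0) (e : EIso L ρ ρ') :
    ∀ k, PIso (fun j => fixDom F L j ∧ j < k) (approx F ρ k) (approx F ρ' k)
  | 0 => ⟨fun j h => absurd h.2 (Nat.not_lt_zero j), fun j h => absurd h.2 (Nat.not_lt_zero j)⟩
  | k + 1 => (F.map (EIso.cons (approxMap hF e k) e)).trunc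
      fun _ hj => dom_fixLev F hF hj.1 (Nat.le_of_lt_succ hj.2)

theorem approxMap_step (hF : F.Ctr 0) (e : EIso L ρ ρ') (k j : ℕ) (hj : fixDom F L j) (hk : j < k)
    (x : (approx F ρ k).obj j) :
    (step F hF ρ' k).eqv j hk ((approxMap F hF e k).eqv j ⟨hj, hk⟩ x)
      = (approxMap F hF e (k + 1)).eqv j ⟨hj, Nat.lt_succ_of_lt hk⟩
        ((step F hF ρ k).eqv j hk x) := by
  induction k generalizing j with
  | zero => exact absurd hk (Nat.not_lt_zero j)
  | succ k ih =>
    have hk' : j ≤ k := Nat.le_of_lt_succ hk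
    let m : EIso (fixLev F L k) (Env.cons (approx F ρ k) ρ) (Env.cons (approx F ρ' (k + 1)) ρ') :=
      EIso.cons ((approxMap F hF e k).trans ((step F hF ρ' k).trunc fun _ h => h.2)) e
    have hle : ∀ i j, fixLev F L k i j → ltLev n k i j := fun i j =>
      Fin.cases (fun h => h.2) (fun _ _ => trivial) i
    have hle' : ∀ i j, fixLev F L k i j → fixLev F L (k + 1) i j := fun i j =>
      Fin.cases (fun h => ⟨h.1, Nat.lt_succ_of_lt h.2⟩) (fun _ h => h) i
    have d := dom_fixLev F hF hj hk'
    refine (F.map_comp (M := fixLev F L k) (EIso.cons (approxMap F hF e k) e)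
      (EIso.cons (step F hF ρ' k) fun i => PIso.refl (fun _ => True) (ρ' i)) m
      (fun _ _ h => h) hle j d d (dom_lt F hF hk') d ?_ x).symm.trans
      (F.map_comp (M := fixLev F L k)
        (EIso.cons (step F hF ρ k) fun i => PIso.refl (fun _ => True) (ρ i))
        (EIso.cons (approxMap F hF e (k + 1)) e) m hle hle' j d (dom_lt F hF hk')
        (dom_fixLev F hF hj (Nat.le_succ_of_le hk')) d ?_ x)
    · intro i j' _
      exact Fin.cases (fun _ _ _ => rfl) (fun _ _ _ _ => rfl) i
    · intro i j' _
      exact Fin.cases (fun hM _ y => ih j' hM.1 hM.2 y) (fun _ _ _ _ => rfl) i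

/-- The action of the fixed point on isomorphisms. -/
def fixMap (hF : F.Ctr 0) (e : EIso L ρ ρ') : PIso (fixDom F L) (fixObj F hF ρ) (fixObj F hF ρ') where
  eqv j h := (approxMap F hF e (j + 1)).eqv j ⟨h, Nat.lt_succ_self j⟩
  nat j h h' x := by
    refine ((Equiv.symm_apply_eq _).mpr ?_).symm
    refine Eq.trans ?_ (approxMap_step F hF e (j + 1) j h (Nat.lt_succ_self j) _).symm
    refine ((approxMap F hF e (j + 2)).nat j ⟨h, by omega⟩ ⟨h', by omega⟩ x).symm.trans ?_
    exact congrArg _ (Equiv.apply_symm_apply _ _).symm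

theorem approxMap_trans (hF : F.Ctr 0) {ρ'' : Env n} (e : EIso L ρ ρ') (e' : EIso L ρ' ρ'') (k j : ℕ)
    (h : fixDom F L j ∧ j < k) (x : (approx F ρ k).obj j) :
    (approxMap F hF (e.trans e') k).eqv j h x
      = (approxMap F hF e' k).eqv j h ((approxMap F hF e k).eqv j h x) := by
  induction k generalizing j with
  | zero => exact absurd h.2 (Nat.not_lt_zero j)
  | succ k ih =>
    have d := dom_fixLev F hF h.1 (Nat.le_of_lt_succ h.2)
    refine F.map_comp (M := fixLev F L k) (EIso.cons (approxMap F hF e k) e)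
      (EIso.cons (approxMap F hF e' k) e') (EIso.cons (approxMap F hF (e.trans e') k) (e.trans e'))
      (fun _ _ h => h) (fun _ _ h => h) j d d d d ?_ x
    intro i j' _
    exact Fin.cases (fun hM _ y => ih j' hM y) (fun _ _ _ _ => rfl) i

theorem approxMap_congr (hF : F.Ctr 0) {L' : Lev n} (e : EIso L ρ ρ') (e' : EIso L' ρ ρ') (k j : ℕ)
    (h : fixDom F L j ∧ j < k) (h' : fixDom F L' j ∧ j < k)
    (H : ∀ i j', j' ≤ j → ∀ (hL : L i j') (hL' : L' i j'),
      (e i).eqv j' hL = (e' i).eqv j' hL') :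
    (approxMap F hF e k).eqv j h = (approxMap F hF e' k).eqv j h' := by
  induction k generalizing j with
  | zero => exact absurd h.2 (Nat.not_lt_zero j)
  | succ k ih =>
    refine F.map_congr (EIso.cons (approxMap F hF e k) e) (EIso.cons (approxMap F hF e' k) e') j
      (dom_fixLev F hF h.1 (Nat.le_of_lt_succ h.2))
      (dom_fixLev F hF h'.1 (Nat.le_of_lt_succ h'.2)) ?_
    intro i j' hj'
    exact Fin.cases (fun hL hL' => ih j' hL hL' fun i k hk => H i k (hk.trans hj'))
      (fun i => H i j' hj') i

end Fix

/-- The functor that maps `W` to the fixed point of `X ↦ F (X, W)`. -/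
def fix {n : ℕ} (F : TyFun (n + 1)) (hF : F.Ctr 0) : TyFun n where
  obj := fixObj F hF
  dom := fixDom F
  map e := fixMap F hF e
  dom_mono {_ _ _} h d j' hj' := F.dom_mono (fun i => Fin.cases (fun _ _ _ => trivial)
    (fun i k hk => h i k (hk.trans hj')) i) (d j' hj')
  dom_top h _ j' _ := F.dom_top (fun i => Fin.cases (fun _ => trivial) h i) j'
  map_trans e e' j h x := approxMap_trans F hF e e' (j + 1) j ⟨h, Nat.lt_succ_self j⟩ x
  map_congr e e' j h h' H := approxMap_congr F hF e e' (j + 1) j ⟨h, Nat.lt_succ_self j⟩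
    ⟨h', Nat.lt_succ_self j⟩ H

/-! ### Contractiveness of the constructions -/

theorem ctr_var {n : ℕ} {i j : Fin n} (h : j ≠ i) : (var j).Ctr i :=
  fun _ _ k H _ d => H j h k le_rfl d

theorem ctr_const {n : ℕ} (X : Tree) (i : Fin n) : (const X : TyFun n).Ctr i :=
  fun _ _ _ _ _ _ => trivial

theorem Ctr.prod {n : ℕ} {F G : TyFun n} {i : Fin n} (hF : F.Ctr i) (hG : G.Ctr i) :
    (F.prod G).Ctr i :=
  fun L L' j H H' d => ⟨hF L L' j H H' d.1, hG L L' j H H' d.2⟩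

theorem Ctr.sum {n : ℕ} {F G : TyFun n} {i : Fin n} (hF : F.Ctr i) (hG : G.Ctr i) :
    (F.sum G).Ctr i :=
  fun L L' j H H' d => ⟨hF L L' j H H' d.1, hG L L' j H H' d.2⟩

theorem Ctr.exp {n : ℕ} {F G : TyFun n} {i : Fin n} (hF : F.Ctr i) (hG : G.Ctr i) :
    (F.exp G).Ctr i :=
  fun L L' _ H H' d j' hj' =>
    ⟨hF L L' j' (fun i' hi' k hk => H i' hi' k (hk.trans hj')) (fun k hk => H' k (hk.trans_le hj'))
      (d j' hj').1,
    hG L L' j' (fun i' hi' k hk => H i' hi' k (hk.trans hj')) (fun k hk => H' k (hk.trans_le hj'))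
      (d j' hj').2⟩

theorem ctr_later {n : ℕ} (F : TyFun n) (i : Fin n) : F.later.Ctr i := by
  intro L L' j
  cases j with
  | zero => exact fun _ _ _ => trivial
  | succ j =>
    intro H H' d
    refine F.dom_mono (fun i' k hk hL => ?_) d
    by_cases hi : i' = i
    · subst hi; exact H' k (Nat.lt_succ_of_le hk)
    · exact H i' hi k (Nat.le_succ_of_le hk) hL

theorem Ctr.fix {n : ℕ} {F : TyFun (n + 1)} {hF : F.Ctr 0} {i : Fin n} (h : F.Ctr i.succ) :
    (F.fix hF).Ctr i := by
  refine fun L L' j H H' d j' hj' => ?_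
  refine h _ _ j' ?_ (fun k hk => H' k (hk.trans_le hj')) (d j' hj')
  intro i'
  refine Fin.cases (fun _ _ _ _ => trivial) (fun i' hi' k hk => ?_) i'
  exact H i' (fun e => hi' (congrArg Fin.succ e)) k (hk.trans hj')

end TyFun

/-- The interpretation of an open type, with the fact that it is contractive in the variables that
are guarded. -/
def Ty.denAux : {n : ℕ} → (A : Ty n) → A.WF →
    { F : TyFun n // ∀ i, A.Guarded i → F.Ctr i }
  | _, .var i, _ => ⟨TyFun.var i, fun _ h => TyFun.ctr_var h⟩
  | _, .nat, _ => ⟨TyFun.const (Tree.delta ℕ), fun i _ => TyFun.ctr_const _ i⟩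
  | _, .one, _ => ⟨TyFun.const Tree.one, fun i _ => TyFun.ctr_const _ i⟩
  | _, .prod A B, h => ⟨(denAux A h.1).1.prod (denAux B h.2).1,
      fun i hi => ((denAux A h.1).2 i hi.1).prod ((denAux B h.2).2 i hi.2)⟩
  | _, .zero, _ => ⟨TyFun.const (Tree.delta Empty), fun i _ => TyFun.ctr_const _ i⟩
  | _, .sum A B, h => ⟨(denAux A h.1).1.sum (denAux B h.2).1,
      fun i hi => ((denAux A h.1).2 i hi.1).sum ((denAux B h.2).2 i hi.2)⟩
  | _, .arr A B, h => ⟨(denAux A h.1).1.exp (denAux B h.2).1,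
      fun i hi => ((denAux A h.1).2 i hi.1).exp ((denAux B h.2).2 i hi.2)⟩
  | _, .mu A, h => ⟨(denAux A h.1).1.fix ((denAux A h.1).2 0 h.2),
      fun i hi => TyFun.Ctr.fix ((denAux A h.1).2 i.succ hi)⟩
  | _, .later A, h => ⟨(denAux A h).1.later, fun i _ => TyFun.ctr_later _ i⟩
  | _, .box A, h => ⟨TyFun.const ((denAux A h).1.obj Fin.elim0).box,
      fun i _ => TyFun.ctr_const _ i⟩

/-- The interpretation of an open type as a functor. -/
def Ty.den {n : ℕ} (A : Ty n) (h : A.WF) : TyFun n := (A.denAux h).1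

theorem Ty.den_ctr {n : ℕ} (A : Ty n) (h : A.WF) (i : Fin n) (hi : A.Guarded i) :
    (A.den h).Ctr i := (A.denAux h).2 i hi

/-! ### Substitution of types -/

/-- Functors between environments. -/
structure ESub (m n : ℕ) : Type 1 where
  obj : Env m → Env n
  dom : Lev m → Lev n
  map : ∀ {L : Lev m} {ρ ρ' : Env m}, EIso L ρ ρ' → EIso (dom L) (obj ρ) (obj ρ')
  dom_mono : ∀ {L L' : Lev m} {j : ℕ}, (∀ i j', j' ≤ j → L i j' → L' i j') →
    ∀ i, dom L i j → dom L' i j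
  dom_top : ∀ {L : Lev m}, (∀ i j, L i j) → ∀ i j, dom L i j
  map_trans : ∀ {L : Lev m} {ρ ρ' ρ'' : Env m} (e : EIso L ρ ρ') (e' : EIso L ρ' ρ'') i j
    (h : dom L i j) x,
    (map (e.trans e') i).eqv j h x = (map e' i).eqv j h ((map e i).eqv j h x)
  map_congr : ∀ {L L' : Lev m} {ρ ρ' : Env m} (e : EIso L ρ ρ') (e' : EIso L' ρ ρ') i j
    (h : dom L i j) (h' : dom L' i j),
    (∀ i j', j' ≤ j → ∀ (hL : L i j') (hL' : L' i j'), (e i).eqv j' hL = (e' i).eqv j' hL') →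
    (map e i).eqv j h = (map e' i).eqv j h'

/-- Precomposition with a functor between environments. -/
def TyFun.comp {m n : ℕ} (F : TyFun n) (S : ESub m n) : TyFun m where
  obj ρ := F.obj (S.obj ρ)
  dom L := F.dom (S.dom L)
  map e := F.map (S.map e)
  dom_mono h d := F.dom_mono
    (fun i _ hj => S.dom_mono (fun i k hk => h i k (hk.trans hj)) i) d
  dom_top h := F.dom_top (S.dom_top h)
  map_trans e e' j h x := by
    rw [← F.map_trans, F.map_congr (S.map (e.trans e')) (EIso.trans (S.map e) (S.map e')) j h h]
    exact fun i j' _ hL _ => Equiv.ext fun x => S.map_trans e e' i j' hL x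
  map_congr e e' j h h' H := F.map_congr _ _ j h h' fun i j' hj' hL hL' =>
    S.map_congr e e' i j' hL hL' fun i k hk => H i k (hk.trans hj')

namespace ESub

def wk (n : ℕ) : ESub (n + 1) n where
  obj ρ i := ρ i.succ
  dom L i := L i.succ
  map e i := e i.succ
  dom_mono {_ _ j} h i := h i.succ j le_rfl
  dom_top h i := h i.succ
  map_trans _ _ _ _ _ _ := rfl
  map_congr _ _ i j h h' H := H i.succ j le_rfl h h'

def lift {m n : ℕ} (S : ESub m n) : ESub (m + 1) (n + 1) where
  obj ρ := Env.cons (ρ 0) (S.obj fun i => ρ i.succ)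
  dom L := Lev.cons (L 0) (S.dom fun i => L i.succ)
  map e := EIso.cons (e 0) (S.map fun i => e i.succ)
  dom_mono {_ _ _} h i := Fin.cases (h 0 _ le_rfl) (S.dom_mono fun i => h i.succ) i
  dom_top h i := Fin.cases (h 0) (S.dom_top fun i => h i.succ) i
  map_trans e e' i := Fin.cases (fun _ _ _ => rfl)
    (S.map_trans (fun i => e i.succ) fun i => e' i.succ) i
  map_congr e e' i := Fin.cases (fun j h h' H => H 0 j le_rfl h h')
    (fun i j h h' H => S.map_congr (fun i => e i.succ) (fun i => e' i.succ) i j h h'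
      fun i => H i.succ) i

/-- Instantiation of the last variable. -/
def inst {n : ℕ} (F : TyFun n) : ESub n (n + 1) where
  obj ρ := Env.cons (F.obj ρ) ρ
  dom L := Lev.cons (F.dom L) L
  map e := EIso.cons (F.map e) e
  dom_mono {_ _ j} h i := Fin.cases (F.dom_mono h) (fun i => h i j le_rfl) i
  dom_top h i := Fin.cases (F.dom_top h) h i
  map_trans e e' i := Fin.cases (F.map_trans e e') (fun _ _ _ _ => rfl) i
  map_congr e e' i := Fin.cases (F.map_congr e e') (fun i j h h' H => H i j le_rfl h h') i

end ESub

theorem PIso.ext {U : ℕ → Prop} {X Y : Tree} {e e' : PIso U X Y}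
    (h : ∀ j hj, e.eqv j hj = e'.eqv j hj) : e = e' := by
  cases e; cases e'
  congr
  funext j hj
  exact h j hj

theorem TyFun.ext_heq {n : ℕ} {F G : TyFun n} (hobj : ∀ ρ, F.obj ρ = G.obj ρ)
    (hdom : ∀ L, F.dom L = G.dom L)
    (hmap : ∀ {L : Lev n} {ρ ρ' : Env n} (e : EIso L ρ ρ') j hj hj',
      HEq ((F.map e).eqv j hj) ((G.map e).eqv j hj')) : F = G := by
  obtain ⟨fo, fd, fm, _, _, _, _⟩ := F
  obtain ⟨go, gd, gm, _, _, _, _⟩ := G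
  obtain rfl : fo = go := funext hobj
  obtain rfl : fd = gd := funext hdom
  obtain rfl : @fm = @gm := by
    funext L ρ ρ' e
    exact PIso.ext fun j hj => eq_of_heq (hmap e j hj hj)
  rfl

theorem ESub.map_refl {m n : ℕ} (S : ESub m n) {L : Lev m} (ρ : Env m) (i : Fin n) (j : ℕ)
    (h : S.dom L i j) : (S.map (fun i => PIso.refl (L i) (ρ i)) i).eqv j h = Equiv.refl _ := by
  refine Equiv.ext fun x => ?_
  have := S.map_trans (fun i => PIso.refl (L i) (ρ i)) (fun i => PIso.refl (L i) (ρ i)) i j h x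
  exact (((S.map (fun i => PIso.refl (L i) (ρ i)) i).eqv j h).injective this).symm

theorem TyFun.Ctr.comp_lift {m n : ℕ} {F : TyFun (n + 1)} (hF : F.Ctr 0) (S : ESub m n) :
    (F.comp S.lift).Ctr 0 := by
  intro L L' j H H' d
  refine hF _ _ j (fun i => ?_) H' d
  refine Fin.cases (fun h => absurd rfl h) (fun i _ j' hj' => ?_) i
  exact S.dom_mono (fun i k hk => H i.succ (Fin.succ_ne_zero i) k (hk.trans hj')) i

theorem TyFun.approx_comp {m n : ℕ} (F : TyFun (n + 1)) (S : ESub m n) (ρ : Env m) (k : ℕ) :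
    approx F (S.obj ρ) k = approx (F.comp S.lift) ρ k := rfl

theorem TyFun.step_comp {m n : ℕ} {F : TyFun (n + 1)} (hF : F.Ctr 0) (S : ESub m n)
    (ρ : Env m) (k : ℕ) :
    step F hF (S.obj ρ) k = step (F.comp S.lift) (hF.comp_lift S) ρ k := by
  induction k with
  | zero => exact PIso.ext fun j hj => absurd hj (Nat.not_lt_zero j)
  | succ k ih =>
    refine PIso.ext fun j hj => ?_
    refine F.map_congr (EIso.cons (step F hF (S.obj ρ) k) fun i => PIso.refl (fun _ => True) _)
      (EIso.cons (step (F.comp S.lift) (hF.comp_lift S) ρ k)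
        (S.map fun i => PIso.refl (fun _ => True) (ρ i))) j _ _ fun i j' _ => ?_
    refine Fin.cases (fun hL hL' => ?_) (fun i hL hL' => ?_) i
    · exact congrArg (fun e => PIso.eqv e j' hL) ih
    · exact (S.map_refl ρ i j' hL').symm

theorem TyFun.fixObj_comp {m n : ℕ} {F : TyFun (n + 1)} (hF : F.Ctr 0) (S : ESub m n)
    (ρ : Env m) :
    fixObj F hF (S.obj ρ) = fixObj (F.comp S.lift) (hF.comp_lift S) ρ :=
  congrArg (fun st : ∀ k, PIso (fun j => j < k) (approx F (S.obj ρ) k) (approx F (S.obj ρ) (k + 1))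
      => (⟨fun i => (approx F (S.obj ρ) (i + 1)).obj i, fun i x =>
        ((st (i + 1)).eqv i (Nat.lt_succ_self i)).symm ((approx F (S.obj ρ) (i + 2)).r i x)⟩ : Tree))
    (funext fun k => step_comp hF S ρ k)

theorem TyFun.approxMap_comp {m n : ℕ} {F : TyFun (n + 1)} (hF : F.Ctr 0) (S : ESub m n)
    {L : Lev m} {ρ ρ' : Env m} (e : EIso L ρ ρ') (k : ℕ) :
    approxMap F hF (S.map e) k = approxMap (F.comp S.lift) (hF.comp_lift S) e k := by
  induction k with
  | zero => exact PIso.ext fun j hj => absurd hj.2 (Nat.not_lt_zero j)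
  | succ k ih =>
    refine PIso.ext fun j hj => ?_
    refine F.map_congr (EIso.cons (approxMap F hF (S.map e) k) (S.map e))
      (EIso.cons (approxMap (F.comp S.lift) (hF.comp_lift S) e k) (S.map e)) j _ _ fun i j' _ => ?_
    refine Fin.cases (fun hL hL' => ?_) (fun i hL hL' => rfl) i
    exact congrArg (fun e => PIso.eqv e j' hL) ih

theorem TyFun.fix_comp {m n : ℕ} {F : TyFun (n + 1)} (hF : F.Ctr 0) (S : ESub m n) :
    (F.fix hF).comp S = (F.comp S.lift).fix (hF.comp_lift S) := by
  refine TyFun.ext_heq (fun ρ => fixObj_comp hF S ρ) (fun _ => rfl) fun e j hj hj' => ?_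
  exact heq_of_eq (congrArg (fun e => PIso.eqv e j ⟨hj, Nat.lt_succ_self j⟩)
    (approxMap_comp hF S e (j + 1)))

theorem TyFun.fix_congr {n : ℕ} {F G : TyFun (n + 1)} (h : F = G) (hF : F.Ctr 0) (hG : G.Ctr 0) :
    F.fix hF = G.fix hG := by
  subst h; rfl

theorem Ty.den_ren {n : ℕ} (A : Ty n) : ∀ {m : ℕ} (ξ : Fin n → Fin m) (S : ESub m n)
    (_ : ∀ i, (TyFun.var i).comp S = TyFun.var (ξ i)) (h : A.WF) (h' : (A.ren ξ).WF),
    (A.ren ξ).den h' = (A.den h).comp S := by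
  induction A with
  | var i => intro m ξ S hS h h'; exact (hS i).symm
  | nat => intros; rfl
  | one => intros; rfl
  | zero => intros; rfl
  | box => intros; rfl
  | later A ih =>
    intro m ξ S hS h h'
    exact congrArg TyFun.later (ih ξ S hS h h')
  | prod A B ihA ihB =>
    intro m ξ S hS h h'
    exact congrArg₂ TyFun.prod (ihA ξ S hS h.1 h'.1) (ihB ξ S hS h.2 h'.2)
  | sum A B ihA ihB =>
    intro m ξ S hS h h'
    exact congrArg₂ TyFun.sum (ihA ξ S hS h.1 h'.1) (ihB ξ S hS h.2 h'.2)
  | arr A B ihA ihB =>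
    intro m ξ S hS h h'
    exact congrArg₂ TyFun.exp (ihA ξ S hS h.1 h'.1) (ihB ξ S hS h.2 h'.2)
  | mu A ih =>
    intro m ξ S hS h h'
    refine Eq.trans ?_ (TyFun.fix_comp (A.den_ctr h.1 0 h.2) S).symm
    refine TyFun.fix_congr (ih _ S.lift (fun i => ?_) h.1 h'.1) _ _
    exact Fin.cases rfl (fun i => congrArg (fun F => TyFun.comp F (ESub.wk m)) (hS i)) i

theorem Ty.den_subst {n : ℕ} (A : Ty n) : ∀ {m : ℕ} (σ : Fin n → Ty m) (S : ESub m n)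
    (hσ : ∀ i, (σ i).WF) (_ : ∀ i, (TyFun.var i).comp S = (σ i).den (hσ i)) (h : A.WF)
    (h' : (A.subst σ).WF), (A.subst σ).den h' = (A.den h).comp S := by
  induction A with
  | var i => intro m σ S hσ hS h h'; exact (hS i).symm
  | nat => intros; rfl
  | one => intros; rfl
  | zero => intros; rfl
  | box => intros; rfl
  | later A ih =>
    intro m σ S hσ hS h h'
    exact congrArg TyFun.later (ih σ S hσ hS h h')
  | prod A B ihA ihB =>
    intro m σ S hσ hS h h'
    exact congrArg₂ TyFun.prod (ihA σ S hσ hS h.1 h'.1) (ihB σ S hσ hS h.2 h'.2)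
  | sum A B ihA ihB =>
    intro m σ S hσ hS h h'
    exact congrArg₂ TyFun.sum (ihA σ S hσ hS h.1 h'.1) (ihB σ S hσ hS h.2 h'.2)
  | arr A B ihA ihB =>
    intro m σ S hσ hS h h'
    exact congrArg₂ TyFun.exp (ihA σ S hσ hS h.1 h'.1) (ihB σ S hσ hS h.2 h'.2)
  | mu A ih =>
    intro m σ S hσ hS h h'
    refine Eq.trans ?_ (TyFun.fix_comp (A.den_ctr h.1 0 h.2) S).symm
    refine TyFun.fix_congr (ih _ S.lift
      (fun i => Fin.cases trivial (fun i => wf_ren _ _ (hσ i)) i) (fun i => ?_) h.1 h'.1) _ _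
    refine Fin.cases rfl (fun i => ?_) i
    refine (congrArg (fun F => TyFun.comp F (ESub.wk m)) (hS i)).trans ?_
    exact (den_ren (σ i) Fin.succ (ESub.wk m) (fun _ => rfl) (hσ i) _).symm

/-! ### Closed types -/

/-- The closed well-formed types. -/
def CTy : Type := { A : Ty 0 // A.WF }

namespace CTy

def nat : CTy := ⟨.nat, trivial⟩

def one : CTy := ⟨.one, trivial⟩

def prod (A B : CTy) : CTy := ⟨.prod A.1 B.1, A.2, B.2⟩

def zero : CTy := ⟨.zero, trivial⟩

def sum (A B : CTy) : CTy := ⟨.sum A.1 B.1, A.2, B.2⟩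

def arr (A B : CTy) : CTy := ⟨.arr A.1 B.1, A.2, B.2⟩

def mu (A : Ty 1) (h : (Ty.mu A : Ty 0).WF) : CTy := ⟨.mu A, h⟩

/-- `A[μ α. A / α]`. -/
def unfolding (A : Ty 1) (h : (Ty.mu A : Ty 0).WF) : CTy := ⟨A.unfolding, Ty.wf_unfolding h⟩

def later (A : CTy) : CTy := ⟨.later A.1, A.2⟩

def box (A : CTy) : CTy := ⟨.box A.1, A.2⟩

def Constant (A : CTy) : Prop := A.1.Constant

/-- The object of the topos of trees that interprets a closed type. -/
def den (A : CTy) : Tree := (A.1.den A.2).obj Fin.elim0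

theorem den_nat : nat.den = Tree.delta ℕ := rfl
theorem den_one : one.den = Tree.one := rfl
theorem den_prod (A B : CTy) : (A.prod B).den = A.den.prod B.den := rfl
theorem den_zero : zero.den = Tree.delta Empty := rfl
theorem den_sum (A B : CTy) : (A.sum B).den = A.den.sum B.den := rfl
theorem den_arr (A B : CTy) : (A.arr B).den = A.den.exp B.den := rfl
theorem den_later (A : CTy) : A.later.den = A.den.later := rfl
theorem den_box (A : CTy) : A.box.den = A.den.box := rfl

/-- The interpretation of `A[μ α. A / α]` is the functor `A` applied to that of `μ α. A`. -/
theorem den_unfolding (A : Ty 1) (h : (Ty.mu A : Ty 0).WF) :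
    (unfolding A h).den = (A.den h.1).obj (Env.cons (mu A h).den Fin.elim0) := by
  have := Ty.den_subst A (fun _ => Ty.mu A) (ESub.inst ((Ty.mu A).den h)) (fun _ => h)
    (fun i => by rw [Subsingleton.elim i 0]; rfl) h.1 (Ty.wf_unfolding h)
  exact congrArg (fun F => TyFun.obj F Fin.elim0) this

end CTy

/-- The identity arrow between equal objects. -/
def Hom.ofEq {X Y : Tree} (h : X = Y) : Hom X Y :=
  ⟨fun i => cast (by rw [h]), fun i x => by subst h; rfl⟩

/-- The isomorphism from the interpretation of `A[μ α. A / α]` to that of `μ α. A`. -/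
def foldHom (A : Ty 1) (h : (Ty.mu A : Ty 0).WF) :
    Hom (CTy.unfolding A h).den (CTy.mu A h).den :=
  (Hom.ofEq (CTy.den_unfolding A h)).comp
    ((TyFun.foldIso (A.den h.1) (A.den_ctr h.1 0 h.2) Fin.elim0).hom fun _ => trivial)

/-- The inverse of `foldHom`. -/
def unfoldHom (A : Ty 1) (h : (Ty.mu A : Ty 0).WF) :
    Hom (CTy.mu A h).den (CTy.unfolding A h).den :=
  ((TyFun.foldIso (A.den h.1) (A.den_ctr h.1 0 h.2) Fin.elim0).inv fun _ => trivial).comp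
    (Hom.ofEq (CTy.den_unfolding A h).symm)

theorem Hom.ofEq_symm_app {X Y : Tree} (h : X = Y) (i : ℕ) (x : X.obj i) :
    (Hom.ofEq h.symm).app i ((Hom.ofEq h).app i x) = x := by
  subst h; rfl

theorem unfoldHom_foldHom (A : Ty 1) (h : (Ty.mu A : Ty 0).WF) (i : ℕ)
    (x : (CTy.unfolding A h).den.obj i) :
    (unfoldHom A h).app i ((foldHom A h).app i x) = x :=
  (congrArg ((Hom.ofEq (CTy.den_unfolding A h).symm).app i) (Equiv.symm_apply_apply _ _)).trans
    (Hom.ofEq_symm_app (CTy.den_unfolding A h) i x)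

theorem foldHom_unfoldHom (A : Ty 1) (h : (Ty.mu A : Ty 0).WF) (i : ℕ)
    (x : (CTy.mu A h).den.obj i) :
    (foldHom A h).app i ((unfoldHom A h).app i x) = x :=
  (congrArg (((TyFun.foldIso (A.den h.1) (A.den_ctr h.1 0 h.2) Fin.elim0).hom
      fun _ => trivial).app i) (Hom.ofEq_symm_app (CTy.den_unfolding A h).symm i _)).trans
    (Equiv.apply_symm_apply _ _)

theorem PIso.isConst {U : ℕ → Prop} {X Y : Tree} (e : PIso U X Y) (hU : ∀ j, U j)
    (h : X.IsConst) : Y.IsConst := by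
  intro i
  have : Y.r i = (e.eqv i (hU i)) ∘ X.r i ∘ (e.eqv (i + 1) (hU (i + 1))).symm := by
    funext y
    simp [e.nat i (hU i) (hU (i + 1))]
  rw [this]
  exact (e.eqv i (hU i)).bijective.comp ((h i).comp (e.eqv (i + 1) (hU (i + 1))).symm.bijective)

theorem Ty.isConst_den {n : ℕ} (A : Ty n) : ∀ (h : A.WF) (_ : A.Constant) (ρ : Env n)
    (_ : ∀ i, A.Guarded i ∨ (ρ i).IsConst), ((A.den h).obj ρ).IsConst := by
  induction A with
  | var i => intro h _ ρ hρ; exact (hρ i).resolve_left fun hi => hi rfl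
  | nat => intros; exact Tree.isConst_delta _
  | one => intros; exact Tree.isConst_delta _
  | zero => intros; exact Tree.isConst_delta _
  | box => intros; exact Tree.isConst_delta _
  | later A ih => intro _ hc; exact hc.elim
  | prod A B ihA ihB =>
    intro h hc ρ hρ
    exact (ihA h.1 hc.1 ρ fun i => (hρ i).imp_left And.left).prod
      (ihB h.2 hc.2 ρ fun i => (hρ i).imp_left And.right)
  | sum A B ihA ihB =>
    intro h hc ρ hρ
    exact (ihA h.1 hc.1 ρ fun i => (hρ i).imp_left And.left).sum
      (ihB h.2 hc.2 ρ fun i => (hρ i).imp_left And.right)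
  | arr A B ihA ihB =>
    intro h hc ρ hρ
    exact Tree.IsConst.exp (ihB h.2 hc.2 ρ fun i => (hρ i).imp_left And.right)
  | mu A ih =>
    intro h hc ρ hρ
    refine (TyFun.foldIso (A.den h.1) (A.den_ctr h.1 0 h.2) ρ).isConst (fun _ => trivial) ?_
    exact ih h.1 hc _ fun i => Fin.cases (Or.inl h.2) hρ i

/-- Constant types denote constant objects. -/
theorem CTy.Constant.isConst {A : CTy} (h : A.Constant) : A.den.IsConst :=
  Ty.isConst_den A.1 A.2 h _ fun i => i.elim0

/-! ## Terms and operational semantics -/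

/-- Untyped terms with `n` free variables, up to renaming of bound variables (de Bruijn indices).
In `caseOf t t₁ t₂` and `lam t`, the branches `t₁`, `t₂` and the body `t` bind the index `0`.
In `prev ts t`, `box ts t` and `boxPlus ts t`, the family `ts` of `m` terms is the explicit
substitution, and the body `t` has precisely the `m` variables bound by it. -/
inductive Tm : ℕ → Type
  | var {n : ℕ} (x : Fin n) : Tm n
  | zero {n : ℕ} : Tm n
  | succ {n : ℕ} (t : Tm n) : Tm n
  | unit {n : ℕ} : Tm n
  | pair {n : ℕ} (t₁ t₂ : Tm n) : Tm n
  | fst {n : ℕ} (t : Tm n) : Tm n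
  | snd {n : ℕ} (t : Tm n) : Tm n
  | abort {n : ℕ} (t : Tm n) : Tm n
  | inl {n : ℕ} (t : Tm n) : Tm n
  | inr {n : ℕ} (t : Tm n) : Tm n
  | caseOf {n : ℕ} (t : Tm n) (t₁ t₂ : Tm (n + 1)) : Tm n
  | lam {n : ℕ} (t : Tm (n + 1)) : Tm n
  | app {n : ℕ} (t₁ t₂ : Tm n) : Tm n
  | fold {n : ℕ} (t : Tm n) : Tm n
  | unfold {n : ℕ} (t : Tm n) : Tm n
  | next {n : ℕ} (t : Tm n) : Tm n
  | prev {n m : ℕ} (ts : Fin m → Tm n) (t : Tm m) : Tm n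
  | lap {n : ℕ} (t₁ t₂ : Tm n) : Tm n
  | box {n m : ℕ} (ts : Fin m → Tm n) (t : Tm m) : Tm n
  | unbox {n : ℕ} (t : Tm n) : Tm n
  | boxPlus {n m : ℕ} (ts : Fin m → Tm n) (t : Tm m) : Tm n

namespace Tm

/-- Renaming of variables. -/
def ren : {n k : ℕ} → (Fin n → Fin k) → Tm n → Tm k
  | _, _, ξ, var x => var (ξ x)
  | _, _, _, zero => zero
  | _, _, ξ, succ t => succ (t.ren ξ)
  | _, _, _, unit => unit
  | _, _, ξ, pair t₁ t₂ => pair (t₁.ren ξ) (t₂.ren ξ)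
  | _, _, ξ, fst t => fst (t.ren ξ)
  | _, _, ξ, snd t => snd (t.ren ξ)
  | _, _, ξ, abort t => abort (t.ren ξ)
  | _, _, ξ, inl t => inl (t.ren ξ)
  | _, _, ξ, inr t => inr (t.ren ξ)
  | _, _, ξ, caseOf t t₁ t₂ => caseOf (t.ren ξ)
      (t₁.ren (Fin.cases 0 fun x => (ξ x).succ)) (t₂.ren (Fin.cases 0 fun x => (ξ x).succ))
  | _, _, ξ, lam t => lam (t.ren (Fin.cases 0 fun x => (ξ x).succ))
  | _, _, ξ, app t₁ t₂ => app (t₁.ren ξ) (t₂.ren ξ)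
  | _, _, ξ, fold t => fold (t.ren ξ)
  | _, _, ξ, unfold t => unfold (t.ren ξ)
  | _, _, ξ, next t => next (t.ren ξ)
  | _, _, ξ, prev ts t => prev (fun i => (ts i).ren ξ) t
  | _, _, ξ, lap t₁ t₂ => lap (t₁.ren ξ) (t₂.ren ξ)
  | _, _, ξ, box ts t => box (fun i => (ts i).ren ξ) t
  | _, _, ξ, unbox t => unbox (t.ren ξ)
  | _, _, ξ, boxPlus ts t => boxPlus (fun i => (ts i).ren ξ) t

/-- A substitution under a binder. -/
def lift {n k : ℕ} (σ : Fin n → Tm k) : Fin (n + 1) → Tm (k + 1) :=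
  Fin.cases (var 0) fun x => (σ x).ren Fin.succ

/-- Simultaneous capture-avoiding substitution. -/
def subst : {n k : ℕ} → (Fin n → Tm k) → Tm n → Tm k
  | _, _, σ, var x => σ x
  | _, _, _, zero => zero
  | _, _, σ, succ t => succ (t.subst σ)
  | _, _, _, unit => unit
  | _, _, σ, pair t₁ t₂ => pair (t₁.subst σ) (t₂.subst σ)
  | _, _, σ, fst t => fst (t.subst σ)
  | _, _, σ, snd t => snd (t.subst σ)
  | _, _, σ, abort t => abort (t.subst σ)
  | _, _, σ, inl t => inl (t.subst σ)
  | _, _, σ, inr t => inr (t.subst σ)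
  | _, _, σ, caseOf t t₁ t₂ => caseOf (t.subst σ) (t₁.subst (lift σ)) (t₂.subst (lift σ))
  | _, _, σ, lam t => lam (t.subst (lift σ))
  | _, _, σ, app t₁ t₂ => app (t₁.subst σ) (t₂.subst σ)
  | _, _, σ, fold t => fold (t.subst σ)
  | _, _, σ, unfold t => unfold (t.subst σ)
  | _, _, σ, next t => next (t.subst σ)
  | _, _, σ, prev ts t => prev (fun i => (ts i).subst σ) t
  | _, _, σ, lap t₁ t₂ => lap (t₁.subst σ) (t₂.subst σ)
  | _, _, σ, box ts t => box (fun i => (ts i).subst σ) t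
  | _, _, σ, unbox t => unbox (t.subst σ)
  | _, _, σ, boxPlus ts t => boxPlus (fun i => (ts i).subst σ) t

/-- The empty explicit substitution. -/
def nil : Fin 0 → Tm 0 := Fin.elim0

end Tm

/-- The reduction rules on closed terms. -/
inductive Rule : Tm 0 → Tm 0 → Prop
  | fst_pair (t₁ t₂ : Tm 0) : Rule (.fst (.pair t₁ t₂)) t₁
  | snd_pair (t₁ t₂ : Tm 0) : Rule (.snd (.pair t₁ t₂)) t₂
  | case_inl (t : Tm 0) (t₁ t₂ : Tm 1) :
      Rule (.caseOf (.inl t) t₁ t₂) (t₁.subst fun _ => t)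
  | case_inr (t : Tm 0) (t₁ t₂ : Tm 1) :
      Rule (.caseOf (.inr t) t₁ t₂) (t₂.subst fun _ => t)
  | beta (t₁ : Tm 1) (t₂ : Tm 0) : Rule (.app (.lam t₁) t₂) (t₁.subst fun _ => t₂)
  | unfold_fold (t : Tm 0) : Rule (.unfold (.fold t)) t
  | prev_subst {m : ℕ} (hm : m ≠ 0) (ts : Fin m → Tm 0) (t : Tm m) :
      Rule (.prev ts t) (.prev Tm.nil (t.subst ts))
  | prev_next (t : Tm 0) : Rule (.prev Tm.nil (.next t)) t
  | lap_next (t₁ t₂ : Tm 0) : Rule (.lap (.next t₁) (.next t₂)) (.next (.app t₁ t₂))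
  | unbox_box {m : ℕ} (ts : Fin m → Tm 0) (t : Tm m) :
      Rule (.unbox (.box ts t)) (t.subst ts)
  | boxPlus_subst {m : ℕ} (hm : m ≠ 0) (ts : Fin m → Tm 0) (t : Tm m) :
      Rule (.boxPlus ts t) (.boxPlus Tm.nil (t.subst ts))
  | boxPlus_inl (t : Tm 0) : Rule (.boxPlus Tm.nil (.inl t)) (.inl (.box Tm.nil t))
  | boxPlus_inr (t : Tm 0) : Rule (.boxPlus Tm.nil (.inr t)) (.inr (.box Tm.nil t))

/-- Closed values. -/
inductive Value : Tm 0 → Prop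
  | num (k : ℕ) : Value (Tm.succ^[k] Tm.zero)
  | unit : Value .unit
  | pair (t₁ t₂ : Tm 0) : Value (.pair t₁ t₂)
  | inl (t : Tm 0) : Value (.inl t)
  | inr (t : Tm 0) : Value (.inr t)
  | lam (t : Tm 1) : Value (.lam t)
  | fold (t : Tm 0) : Value (.fold t)
  | next (t : Tm 0) : Value (.next t)
  | box {m : ℕ} (ts : Fin m → Tm 0) (t : Tm m) : Value (.box ts t)

/-- Evaluation contexts (on closed terms). -/
inductive ECtx : Type
  | hole : ECtx
  | succ (E : ECtx) : ECtx
  | fst (E : ECtx) : ECtx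
  | snd (E : ECtx) : ECtx
  | caseOf (E : ECtx) (t₁ t₂ : Tm 1) : ECtx
  | app (E : ECtx) (t : Tm 0) : ECtx
  | unfold (E : ECtx) : ECtx
  | prev (E : ECtx) : ECtx
  | lapLeft (E : ECtx) (t : Tm 0) : ECtx
  | lapRight (v : Tm 0) (hv : Value v) (E : ECtx) : ECtx
  | unbox (E : ECtx) : ECtx
  | boxPlus (E : ECtx) : ECtx

/-- The term `E[t]`. -/
def ECtx.plug : ECtx → Tm 0 → Tm 0
  | hole, t => t
  | succ E, t => .succ (E.plug t)
  | fst E, t => .fst (E.plug t)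
  | snd E, t => .snd (E.plug t)
  | caseOf E t₁ t₂, t => .caseOf (E.plug t) t₁ t₂
  | app E s, t => .app (E.plug t) s
  | unfold E, t => .unfold (E.plug t)
  | prev E, t => .prev Tm.nil (E.plug t)
  | lapLeft E s, t => .lap (E.plug t) s
  | lapRight v _ E, t => .lap v (E.plug t)
  | unbox E, t => .unbox (E.plug t)
  | boxPlus E, t => .boxPlus Tm.nil (E.plug t)

/-- One step of call-by-name reduction: `E[t] ↦ E[u]` where `t ↦ u` is a reduction rule. -/
inductive Step : Tm 0 → Tm 0 → Prop
  | mk (E : ECtx) {t u : Tm 0} (h : Rule t u) : Step (E.plug t) (E.plug u)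

/-- Call-by-name reduction in many steps: the reflexive transitive closure of `Step`. -/
def Steps : Tm 0 → Tm 0 → Prop := Relation.ReflTransGen Step

/-! ## Typing and the interpretation of terms -/

/-- Typing contexts. -/
abbrev Ctx (n : ℕ) : Type := Fin n → CTy

/-- The empty context. -/
def Ctx.nil : Ctx 0 := Fin.elim0

/-- The extension of a context by a variable, which gets the index `0`. -/
def Ctx.cons {n : ℕ} (A : CTy) (Γ : Ctx n) : Ctx (n + 1) := Fin.cons (α := fun _ => CTy) A Γ

/-- Derivations of the typing judgement `Γ ⊢ t : A`. -/
inductive Typing : {n : ℕ} → Ctx n → Tm n → CTy → Type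
  | var {n : ℕ} {Γ : Ctx n} (x : Fin n) : Typing Γ (.var x) (Γ x)
  | zero {n : ℕ} {Γ : Ctx n} : Typing Γ .zero .nat
  | succ {n : ℕ} {Γ : Ctx n} {t : Tm n} (D : Typing Γ t .nat) : Typing Γ (.succ t) .nat
  | unit {n : ℕ} {Γ : Ctx n} : Typing Γ .unit .one
  | pair {n : ℕ} {Γ : Ctx n} {t₁ t₂ : Tm n} {A B : CTy} (D₁ : Typing Γ t₁ A)
      (D₂ : Typing Γ t₂ B) : Typing Γ (.pair t₁ t₂) (A.prod B)
  | fst {n : ℕ} {Γ : Ctx n} {t : Tm n} {A B : CTy} (D : Typing Γ t (A.prod B)) :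
      Typing Γ (.fst t) A
  | snd {n : ℕ} {Γ : Ctx n} {t : Tm n} {A B : CTy} (D : Typing Γ t (A.prod B)) :
      Typing Γ (.snd t) B
  | abort {n : ℕ} {Γ : Ctx n} {t : Tm n} {A : CTy} (D : Typing Γ t .zero) :
      Typing Γ (.abort t) A
  | inl {n : ℕ} {Γ : Ctx n} {t : Tm n} {A B : CTy} (D : Typing Γ t A) :
      Typing Γ (.inl t) (A.sum B)
  | inr {n : ℕ} {Γ : Ctx n} {t : Tm n} {A B : CTy} (D : Typing Γ t B) :
      Typing Γ (.inr t) (A.sum B)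
  | caseOf {n : ℕ} {Γ : Ctx n} {t : Tm n} {t₁ t₂ : Tm (n + 1)} {A B C : CTy}
      (D : Typing Γ t (A.sum B)) (D₁ : Typing (Γ.cons A) t₁ C) (D₂ : Typing (Γ.cons B) t₂ C) :
      Typing Γ (.caseOf t t₁ t₂) C
  | lam {n : ℕ} {Γ : Ctx n} {t : Tm (n + 1)} {A B : CTy} (D : Typing (Γ.cons A) t B) :
      Typing Γ (.lam t) (A.arr B)
  | app {n : ℕ} {Γ : Ctx n} {t₁ t₂ : Tm n} {A B : CTy} (D₁ : Typing Γ t₁ (A.arr B))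
      (D₂ : Typing Γ t₂ A) : Typing Γ (.app t₁ t₂) B
  | fold {n : ℕ} {Γ : Ctx n} {t : Tm n} {A : Ty 1} (h : (Ty.mu A : Ty 0).WF)
      (D : Typing Γ t (.unfolding A h)) : Typing Γ (.fold t) (.mu A h)
  | unfold {n : ℕ} {Γ : Ctx n} {t : Tm n} {A : Ty 1} (h : (Ty.mu A : Ty 0).WF)
      (D : Typing Γ t (.mu A h)) : Typing Γ (.unfold t) (.unfolding A h)
  | next {n : ℕ} {Γ : Ctx n} {t : Tm n} {A : CTy} (D : Typing Γ t A) :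
      Typing Γ (.next t) A.later
  | prev {n m : ℕ} {Γ : Ctx n} {Δ : Ctx m} {ts : Fin m → Tm n} {t : Tm m} {A : CTy}
      (hΔ : ∀ i, (Δ i).Constant) (D : Typing Δ t A.later) (Ds : ∀ i, Typing Γ (ts i) (Δ i)) :
      Typing Γ (.prev ts t) A
  | lap {n : ℕ} {Γ : Ctx n} {t₁ t₂ : Tm n} {A B : CTy} (D₁ : Typing Γ t₁ (A.arr B).later)
      (D₂ : Typing Γ t₂ A.later) : Typing Γ (.lap t₁ t₂) B.later
  | box {n m : ℕ} {Γ : Ctx n} {Δ : Ctx m} {ts : Fin m → Tm n} {t : Tm m} {A : CTy}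
      (hΔ : ∀ i, (Δ i).Constant) (D : Typing Δ t A) (Ds : ∀ i, Typing Γ (ts i) (Δ i)) :
      Typing Γ (.box ts t) A.box
  | unbox {n : ℕ} {Γ : Ctx n} {t : Tm n} {A : CTy} (D : Typing Γ t A.box) :
      Typing Γ (.unbox t) A
  | boxPlus {n m : ℕ} {Γ : Ctx n} {Δ : Ctx m} {ts : Fin m → Tm n} {t : Tm m} {A B : CTy}
      (hΔ : ∀ i, (Δ i).Constant) (D : Typing Δ t (A.sum B)) (Ds : ∀ i, Typing Γ (ts i) (Δ i)) :
      Typing Γ (.boxPlus ts t) (A.box.sum B.box)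

/-- The interpretation of a typing context: the product of the interpretations of its types. -/
def Ctx.den {n : ℕ} (Γ : Ctx n) : Tree := Tree.pi fun i => (Γ i).den

/-- The object that interprets an extended context is a binary product. -/
def Ctx.consHom {n : ℕ} (A : CTy) (Γ : Ctx n) : Hom (Γ.den.prod A.den) (Γ.cons A).den where
  app _ p := Fin.cases p.2 p.1
  nat _ _ := funext fun k => Fin.cases rfl (fun _ => rfl) k

theorem Ctx.isConst_den {n : ℕ} {Γ : Ctx n} (h : ∀ i, (Γ i).Constant) : Γ.den.IsConst :=
  Tree.IsConst.pi fun i => (h i).isConst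

/-- The interpretation of a typed term in context as an arrow of the topos of trees. -/
def Typing.den : {n : ℕ} → {Γ : Ctx n} → {t : Tm n} → {A : CTy} → Typing Γ t A → Hom Γ.den A.den
  | _, Γ, _, _, .var x => Hom.proj (fun i => (Γ i).den) x
  | _, _, _, _, .zero => Hom.zero
  | _, _, _, _, .succ D => Hom.succ D.den
  | _, _, _, _, .unit => Hom.unit
  | _, _, _, _, .pair D₁ D₂ => Hom.pair D₁.den D₂.den
  | _, _, _, _, .fst D => Hom.fst D.den
  | _, _, _, _, .snd D => Hom.snd D.den
  | _, _, _, _, .abort D => Hom.abort D.den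
  | _, _, _, _, .inl D => Hom.inl D.den
  | _, _, _, _, .inr D => Hom.inr D.den
  | _, Γ, _, _, .caseOf (A := A) (B := B) D D₁ D₂ =>
      Hom.caseOf D.den ((Γ.consHom A).comp D₁.den) ((Γ.consHom B).comp D₂.den)
  | _, Γ, _, _, .lam (A := A) D => Hom.lam ((Γ.consHom A).comp D.den)
  | _, _, _, _, .app D₁ D₂ => Hom.ap D₁.den D₂.den
  | _, _, _, _, .fold h D => D.den.comp (foldHom _ h)
  | _, _, _, _, .unfold h D => D.den.comp (unfoldHom _ h)
  | _, _, _, _, .next D => Hom.next D.den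
  | _, _, _, _, .prev hΔ D Ds =>
      Hom.prev (Ctx.isConst_den hΔ) D.den (Hom.tuple fun i => (Ds i).den)
  | _, _, _, _, .lap D₁ D₂ => Hom.lap D₁.den D₂.den
  | _, _, _, _, .box hΔ D Ds =>
      Hom.box (Ctx.isConst_den hΔ) D.den (Hom.tuple fun i => (Ds i).den)
  | _, _, _, _, .unbox D => Hom.unbox D.den
  | _, _, _, _, .boxPlus hΔ D Ds =>
      Hom.boxPlus (Ctx.isConst_den hΔ) D.den (Hom.tuple fun i => (Ds i).den)

end

end GuardedLambda

open GuardedLambda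

/-! Terms carry no type annotations, so one judgement may have many derivations: the type of a
discarded component, of the argument of an application or of a term in an explicit substitution is
not determined by the final type. The proof therefore has two independent halves. Soundness
(`Steps.sound`) turns a given derivation for `t` into some derivation for `u` with the same
denotation. Coherence (`Typing.den_eq`) says that all derivations of a judgement have the same
denotation. Together they give the result for every derivation for `u`.

Coherence cannot be proved by induction as an equality, because corresponding subderivations may
have different types. The induction is instead on a logical relation `Rel` between elements of
possibly different types at the same stage: functions are related if they preserve relatedness at
all stages up to the current one, and elements of sums if they lie on the same side with related
contents. Any two derivations for a term, in any contexts and at any types, send related arguments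
to related values (`Typing.rel`). At equal types `Rel` is equality (`Rel.iff_eq`), and this is
coherence.

`Rel` is well defined by recursion on the lexicographic triple of the nesting depth of `■`, the
stage, and the size of the type outside `▶` and `■`. The clause for `■` uses all stages but lowers
the depth; `▶` lowers the stage; unfolding a recursive type removes a `μ`, and guardedness hides the
new copies beneath `▶`. The bodies of `prev`, `box` and `box⁺` are evaluated at other stages, so
relatedness at constant types must survive a change of stage (`Rel.move`). This follows from
`Rel.restrict` and its converse for constant types, `Rel.of_restrict`.

For soundness, each rule is checked by inversion, the substitution lemma `Typing.exists_subst`, and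
naturality. Explicit substitutions disappear because closed terms of constant types denote global
elements, which a change of stage leaves alone (`substHom_move`). Evaluation contexts then cause no
difficulty, since their holes are closed. -/

namespace GuardedLambda

/-! ## Measures on types -/

namespace Ty

/-- The nesting depth of `■`. -/
def boxDepth : {n : ℕ} → Ty n → ℕ
  | _, var _ => 0
  | _, nat => 0
  | _, one => 0
  | _, prod A B => max A.boxDepth B.boxDepth
  | _, zero => 0
  | _, sum A B => max A.boxDepth B.boxDepth
  | _, arr A B => max A.boxDepth B.boxDepth
  | _, mu A => A.boxDepth
  | _, later A => A.boxDepth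
  | _, box A => A.boxDepth + 1

/-- The size of the part of a type that is not beneath a `▶` or a `■`. -/
def guardedSize : {n : ℕ} → Ty n → ℕ
  | _, var _ => 0
  | _, nat => 0
  | _, one => 0
  | _, prod A B => A.guardedSize + B.guardedSize + 1
  | _, zero => 0
  | _, sum A B => A.guardedSize + B.guardedSize + 1
  | _, arr A B => A.guardedSize + B.guardedSize + 1
  | _, mu A => A.guardedSize + 1
  | _, later _ => 0
  | _, box _ => 0

theorem boxDepth_ren {n : ℕ} (A : Ty n) : ∀ {m : ℕ} (ξ : Fin n → Fin m),
    (A.ren ξ).boxDepth = A.boxDepth := by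
  induction A <;> intros <;> simp_all [ren, boxDepth]

theorem guardedSize_ren {n : ℕ} (A : Ty n) : ∀ {m : ℕ} (ξ : Fin n → Fin m),
    (A.ren ξ).guardedSize = A.guardedSize := by
  induction A <;> intros <;> simp_all [ren, guardedSize]

theorem constant_ren {n : ℕ} (A : Ty n) : ∀ {m : ℕ} (ξ : Fin n → Fin m),
    A.Constant → (A.ren ξ).Constant := by
  induction A <;> intros <;> simp_all [ren, Constant]

/-- Since `■` applies to closed types only, no substitution acts beneath it, so depths are never
added. The common bound `d` passes unchanged under `μ`. -/
theorem boxDepth_subst_le {n d : ℕ} (A : Ty n) : ∀ {m : ℕ} (σ : Fin n → Ty m),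
    A.boxDepth ≤ d → (∀ i, (σ i).boxDepth ≤ d) → (A.subst σ).boxDepth ≤ d := by
  induction A with
  | mu A ih =>
    intro m σ h hσ
    refine ih _ h fun i => Fin.cases (Nat.zero_le _) (fun i => ?_) i
    exact (boxDepth_ren _ _).trans_le (hσ i)
  | _ => intros; simp_all [subst, boxDepth]

/-- What replaces a guarded variable lands beneath a `▶`, where it is not counted. The alternative
of size zero is there for the variable bound by a `μ`, which a lifted substitution sends to itself.
-/
theorem guardedSize_subst {n : ℕ} (A : Ty n) : ∀ {m : ℕ} (σ : Fin n → Ty m),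
    (∀ i, A.Guarded i ∨ (σ i).guardedSize = 0) → (A.subst σ).guardedSize = A.guardedSize := by
  induction A with
  | var i => intro m σ h; exact (h i).resolve_left fun hi => hi rfl
  | nat => intros; rfl
  | one => intros; rfl
  | zero => intros; rfl
  | later => intros; rfl
  | box => intros; rfl
  | prod A B ihA ihB | sum A B ihA ihB | arr A B ihA ihB =>
    intro m σ h
    simp only [subst, guardedSize, ihA σ fun i => (h i).imp_left And.left,
      ihB σ fun i => (h i).imp_left And.right]
  | mu A ih =>
    intro m σ h
    refine congrArg (· + 1) (ih _ fun i => Fin.cases (Or.inr rfl) (fun i => ?_) i)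
    exact (h i).imp_right (guardedSize_ren _ _).trans

theorem constant_subst {n : ℕ} (A : Ty n) : ∀ {m : ℕ} (σ : Fin n → Ty m),
    A.Constant → (∀ i, (σ i).Constant) → (A.subst σ).Constant := by
  induction A with
  | mu A ih =>
    intro m σ h hσ
    exact ih _ h fun i => Fin.cases trivial (fun i => constant_ren _ _ (hσ i)) i
  | _ => intros; simp_all [subst, Constant]

theorem boxDepth_unfolding_le (A : Ty 1) : A.unfolding.boxDepth ≤ A.boxDepth :=
  boxDepth_subst_le A _ le_rfl fun _ => le_rfl

theorem guardedSize_unfolding {A : Ty 1} (h : A.Guarded 0) :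
    A.unfolding.guardedSize = A.guardedSize :=
  guardedSize_subst A _ fun i => Or.inl (by rwa [Subsingleton.elim i 0])

theorem constant_unfolding {A : Ty 1} (h : A.Constant) : A.unfolding.Constant :=
  constant_subst A _ h fun _ => h

end Ty

/-! ### The well-founded order on types at stages -/

namespace CTy

/-- The order on types at stages along which relations on their interpretations are defined. -/
def rank (A : CTy) (i : ℕ) : ℕ ×ₗ ℕ ×ₗ ℕ :=
  toLex (A.1.boxDepth, toLex (i, A.1.guardedSize))

theorem rank_lt_of_boxDepth {A B : CTy} {i j : ℕ} (h : A.1.boxDepth < B.1.boxDepth) :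
    A.rank i < B.rank j := Prod.Lex.toLex_lt_toLex.2 (Or.inl h)

theorem rank_lt_of_stage {A B : CTy} {i j : ℕ} (h : A.1.boxDepth ≤ B.1.boxDepth) (hij : i < j) :
    A.rank i < B.rank j :=
  Prod.Lex.toLex_lt_toLex.2 <| h.lt_or_eq.imp_right fun h =>
    ⟨h, Prod.Lex.toLex_lt_toLex.2 (Or.inl hij)⟩

theorem rank_lt_of_size {A B : CTy} {i j : ℕ} (h : A.1.boxDepth ≤ B.1.boxDepth) (hij : i ≤ j)
    (hs : A.1.guardedSize < B.1.guardedSize) : A.rank i < B.rank j :=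
  Prod.Lex.toLex_lt_toLex.2 <| h.lt_or_eq.imp_right fun h =>
    ⟨h, Prod.Lex.toLex_lt_toLex.2 <| hij.lt_or_eq.imp_right fun hij => ⟨hij, hs⟩⟩

theorem rank_prod_left (A B : CTy) (i : ℕ) : A.rank i < (A.prod B).rank i :=
  rank_lt_of_size (le_max_left _ _) le_rfl (by simp [prod, Ty.guardedSize])

theorem rank_prod_right (A B : CTy) (i : ℕ) : B.rank i < (A.prod B).rank i :=
  rank_lt_of_size (le_max_right _ _) le_rfl (by simp [prod, Ty.guardedSize])

theorem rank_sum_left (A B : CTy) (i : ℕ) : A.rank i < (A.sum B).rank i :=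
  rank_lt_of_size (le_max_left _ _) le_rfl (by simp [sum, Ty.guardedSize])

theorem rank_sum_right (A B : CTy) (i : ℕ) : B.rank i < (A.sum B).rank i :=
  rank_lt_of_size (le_max_right _ _) le_rfl (by simp [sum, Ty.guardedSize])

/-- An element of an exponential at stage `i` acts at all stages `j ≤ i`, so the stage may drop
along with the size. -/
theorem rank_arr_left (A B : CTy) {i j : ℕ} (h : j ≤ i) : A.rank j < (A.arr B).rank i :=
  rank_lt_of_size (le_max_left _ _) h (by simp [arr, Ty.guardedSize])

theorem rank_arr_right (A B : CTy) {i j : ℕ} (h : j ≤ i) : B.rank j < (A.arr B).rank i :=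
  rank_lt_of_size (le_max_right _ _) h (by simp [arr, Ty.guardedSize])

/-- The stage does not change here, so the size has to decrease: by guardedness the unfolding is
only as large as the body, which lacks the `μ`. -/
theorem rank_unfolding (A : Ty 1) (h : (Ty.mu A : Ty 0).WF) (i : ℕ) :
    (unfolding A h).rank i < (mu A h).rank i :=
  rank_lt_of_size A.boxDepth_unfolding_le le_rfl
    (Nat.lt_succ_of_le (Ty.guardedSize_unfolding h.2).le)

/-- The size can grow on leaving a `▶`, which is why the stage takes precedence over the size. -/
theorem rank_later (A : CTy) (i : ℕ) : A.rank i < A.later.rank (i + 1) :=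
  rank_lt_of_stage le_rfl (Nat.lt_succ_self i)

/-- No relation between `i` and `j` is available, because an element of `■ A` contains values at all
stages. This is why the depth of `■` is the leading component. -/
theorem rank_box (A : CTy) (i j : ℕ) : A.rank j < A.box.rank i :=
  rank_lt_of_boxDepth (Nat.lt_succ_self _)

/-- Induction on closed types and stages: the stage decreases beneath `▶`, a recursive type is
reduced to its unfolding, and `■ A` at any stage is reduced to `A` at all stages. -/
theorem stage_induction {P : CTy → ℕ → Prop} (nat : ∀ i, P nat i) (one : ∀ i, P one i)
    (zero : ∀ i, P zero i) (prod : ∀ A B i, P A i → P B i → P (A.prod B) i)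
    (sum : ∀ A B i, P A i → P B i → P (A.sum B) i)
    (arr : ∀ A B i, (∀ j, j ≤ i → P A j) → (∀ j, j ≤ i → P B j) → P (A.arr B) i)
    (mu : ∀ A h i, P (unfolding A h) i → P (mu A h) i)
    (later_zero : ∀ A : CTy, P A.later 0) (later_succ : ∀ A i, P A i → P A.later (i + 1))
    (box : ∀ A i, (∀ j, P A j) → P A.box i) (A : CTy) (i : ℕ) : P A i := by
  induction hr : A.rank i using WellFoundedLT.induction generalizing A i with
  | ind r ih' =>
  have ih : ∀ (B : CTy) (j : ℕ), B.rank j < A.rank i → P B j := fun B j h =>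
    ih' _ (hr ▸ h) B j rfl
  clear ih' hr
  obtain ⟨A, h⟩ := A
  cases A with
  | var i => exact i.elim0
  | nat => exact nat i
  | one => exact one i
  | zero => exact zero i
  | prod A B =>
    exact prod ⟨A, h.1⟩ ⟨B, h.2⟩ i (ih _ _ (rank_prod_left ⟨A, h.1⟩ ⟨B, h.2⟩ i))
      (ih _ _ (rank_prod_right ⟨A, h.1⟩ ⟨B, h.2⟩ i))
  | sum A B =>
    exact sum ⟨A, h.1⟩ ⟨B, h.2⟩ i (ih _ _ (rank_sum_left ⟨A, h.1⟩ ⟨B, h.2⟩ i))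
      (ih _ _ (rank_sum_right ⟨A, h.1⟩ ⟨B, h.2⟩ i))
  | arr A B =>
    exact arr ⟨A, h.1⟩ ⟨B, h.2⟩ i (fun j hj => ih _ _ (rank_arr_left ⟨A, h.1⟩ ⟨B, h.2⟩ hj))
      (fun j hj => ih _ _ (rank_arr_right ⟨A, h.1⟩ ⟨B, h.2⟩ hj))
  | mu A => exact mu A h i (ih _ _ (rank_unfolding A h i))
  | later A =>
    cases i with
    | zero => exact later_zero ⟨A, h⟩
    | succ i => exact later_succ ⟨A, h⟩ i (ih _ _ (rank_later _ i))
  | box A => exact box ⟨A, h⟩ i fun j => ih _ _ (rank_box _ i j)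

/-! ### Injectivity of the type formers -/

theorem prod_inj {A B A' B' : CTy} (h : A.prod B = A'.prod B') : A = A' ∧ B = B' := by
  have := congrArg Subtype.val h
  injection this with _ h₁ h₂
  exact ⟨Subtype.ext h₁, Subtype.ext h₂⟩

theorem sum_inj {A B A' B' : CTy} (h : A.sum B = A'.sum B') : A = A' ∧ B = B' := by
  have := congrArg Subtype.val h
  injection this with _ h₁ h₂
  exact ⟨Subtype.ext h₁, Subtype.ext h₂⟩

theorem arr_inj {A B A' B' : CTy} (h : A.arr B = A'.arr B') : A = A' ∧ B = B' := by
  have := congrArg Subtype.val h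
  injection this with _ h₁ h₂
  exact ⟨Subtype.ext h₁, Subtype.ext h₂⟩

theorem later_inj {A A' : CTy} (h : A.later = A'.later) : A = A' := by
  have := congrArg Subtype.val h
  injection this with _ h
  exact Subtype.ext h

theorem box_inj {A A' : CTy} (h : A.box = A'.box) : A = A' := by
  have := congrArg Subtype.val h
  injection this with _ h
  exact Subtype.ext h

theorem mu_inj {A A' : Ty 1} {h : (Ty.mu A : Ty 0).WF} {h' : (Ty.mu A' : Ty 0).WF}
    (e : mu A h = mu A' h') : A = A' := by
  have := congrArg Subtype.val e
  injection this

end CTy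

/-! ## A logical relation between the interpretations of closed types -/

/-- The relation between the interpretations of two closed types at a stage. Elements of types with
different outermost type formers are not related. -/
def Rel : (A : CTy) → (i : ℕ) → A.den.obj i → (B : CTy) → B.den.obj i → Prop
  | ⟨.var k, _⟩, _, _, _, _ => k.elim0
  | ⟨.nat, _⟩, i, x, B, y => ∃ e : B = CTy.nat,
      (x : (CTy.den CTy.nat).obj i) = (e ▸ y : (CTy.den CTy.nat).obj i)
  -- The only element carries no information, but the type is still compared: a related element must
  -- determine the outermost former of its type.
  | ⟨.one, _⟩, _, _, B, _ => B = CTy.one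
  | ⟨.zero, _⟩, _, _, B, _ => B = CTy.zero
  | ⟨.prod A₁ A₂, h⟩, i, x, B, y => ∃ (B₁ B₂ : CTy) (e : B = B₁.prod B₂),
      let x : CTy.den ⟨A₁, h.1⟩ |>.prod (CTy.den ⟨A₂, h.2⟩) |>.obj i := x
      let y : (B₁.den.prod B₂.den).obj i := (e ▸ y : (B₁.prod B₂).den.obj i)
      Rel ⟨A₁, h.1⟩ i x.1 B₁ y.1 ∧ Rel ⟨A₂, h.2⟩ i x.2 B₂ y.2
  | ⟨.sum A₁ A₂, h⟩, i, x, B, y => ∃ (B₁ B₂ : CTy) (e : B = B₁.sum B₂),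
      let x : CTy.den ⟨A₁, h.1⟩ |>.sum (CTy.den ⟨A₂, h.2⟩) |>.obj i := x
      let y : (B₁.den.sum B₂.den).obj i := (e ▸ y : (B₁.sum B₂).den.obj i)
      -- Nothing is asked of the summand on the other side: an injection leaves its type
      -- undetermined.
      (∃ a b, x = Sum.inl a ∧ y = Sum.inl b ∧ Rel ⟨A₁, h.1⟩ i a B₁ b) ∨
        ∃ a b, x = Sum.inr a ∧ y = Sum.inr b ∧ Rel ⟨A₂, h.2⟩ i a B₂ b
  | ⟨.arr A₁ A₂, h⟩, i, x, B, y => ∃ (B₁ B₂ : CTy) (e : B = B₁.arr B₂),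
      let x : CTy.den ⟨A₁, h.1⟩ |>.exp (CTy.den ⟨A₂, h.2⟩) |>.obj i := x
      let y : (B₁.den.exp B₂.den).obj i := (e ▸ y : (B₁.arr B₂).den.obj i)
      ∀ j (hj : j ≤ i) a b, Rel ⟨A₁, h.1⟩ j a B₁ b → Rel ⟨A₂, h.2⟩ j (x.1 j hj a) B₂ (y.1 j hj b)
  | ⟨.mu A, h⟩, i, x, B, y => ∃ (B₁ : Ty 1) (h₁ : (Ty.mu B₁ : Ty 0).WF) (e : B = CTy.mu B₁ h₁),
      Rel (CTy.unfolding A h) i ((unfoldHom A h).app i x) (CTy.unfolding B₁ h₁)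
        ((unfoldHom B₁ h₁).app i (e ▸ y : (CTy.mu B₁ h₁).den.obj i))
  -- At the first stage `▶` has one element, so the types beneath the two `▶` may be arbitrary.
  | ⟨.later _, _⟩, 0, _, B, _ => ∃ B₁ : CTy, B = B₁.later
  | ⟨.later A, h⟩, i + 1, x, B, y => ∃ (B₁ : CTy) (e : B = B₁.later),
      Rel ⟨A, h⟩ i x B₁ (e ▸ y : B₁.later.den.obj (i + 1))
  | ⟨.box A, h⟩, i, x, B, y => ∃ (B₁ : CTy) (e : B = B₁.box),
      let x : Hom Tree.one (CTy.den ⟨A, h⟩) := x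
      let y : Hom Tree.one B₁.den := (e ▸ y : B₁.box.den.obj i)
      ∀ j, Rel ⟨A, h⟩ j (x.app j PUnit.unit) B₁ (y.app j PUnit.unit)
termination_by A i => A.rank i
decreasing_by
  · exact CTy.rank_prod_left ⟨A₁, h.1⟩ ⟨A₂, h.2⟩ i
  · exact CTy.rank_prod_right ⟨A₁, h.1⟩ ⟨A₂, h.2⟩ i
  · exact CTy.rank_sum_left ⟨A₁, h.1⟩ ⟨A₂, h.2⟩ i
  · exact CTy.rank_sum_right ⟨A₁, h.1⟩ ⟨A₂, h.2⟩ i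
  · exact CTy.rank_arr_left ⟨A₁, h.1⟩ ⟨A₂, h.2⟩ hj
  · exact CTy.rank_arr_right ⟨A₁, h.1⟩ ⟨A₂, h.2⟩ hj
  · exact CTy.rank_unfolding A h i
  · exact CTy.rank_later ⟨A, h⟩ i
  · exact CTy.rank_box ⟨A, h⟩ i j

namespace Rel

/-! ### The defining clauses -/

section

variable {i : ℕ} {B : CTy}

/-- `Rel` is defined by well-founded recursion and does not unfold by computation. The lemmas of
this section restate its equations, one for each clause, in terms of the type formers on `CTy`. -/
theorem nat_def {x y} : Rel .nat i x B y ↔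
    ∃ e : B = CTy.nat, x = (e ▸ y : (CTy.den CTy.nat).obj i) :=
  iff_of_eq (Rel.eq_2 i B y trivial x)

theorem one_def {x y} : Rel .one i x B y ↔ B = CTy.one :=
  iff_of_eq (Rel.eq_3 i B y trivial x)

theorem prod_def {A₁ A₂ : CTy} {x : (A₁.den.prod A₂.den).obj i} {y} :
    Rel (A₁.prod A₂) i x B y ↔ ∃ (B₁ B₂ : CTy) (e : B = B₁.prod B₂),
      let y : (B₁.den.prod B₂.den).obj i := (e ▸ y : (B₁.prod B₂).den.obj i)
      Rel A₁ i x.1 B₁ y.1 ∧ Rel A₂ i x.2 B₂ y.2 :=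
  iff_of_eq (Rel.eq_5 i B y A₁.1 A₂.1 ⟨A₁.2, A₂.2⟩ x)

theorem sum_def {A₁ A₂ : CTy} {x : (A₁.den.sum A₂.den).obj i} {y} :
    Rel (A₁.sum A₂) i x B y ↔ ∃ (B₁ B₂ : CTy) (e : B = B₁.sum B₂),
      let y : (B₁.den.sum B₂.den).obj i := (e ▸ y : (B₁.sum B₂).den.obj i)
      (∃ a b, x = Sum.inl a ∧ y = Sum.inl b ∧ Rel A₁ i a B₁ b) ∨
        ∃ a b, x = Sum.inr a ∧ y = Sum.inr b ∧ Rel A₂ i a B₂ b :=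
  iff_of_eq (Rel.eq_6 i B y A₁.1 A₂.1 ⟨A₁.2, A₂.2⟩ x)

theorem arr_def {A₁ A₂ : CTy} {f : (A₁.den.exp A₂.den).obj i} {y} :
    Rel (A₁.arr A₂) i f B y ↔ ∃ (B₁ B₂ : CTy) (e : B = B₁.arr B₂),
      let g : (B₁.den.exp B₂.den).obj i := (e ▸ y : (B₁.arr B₂).den.obj i)
      ∀ j (hj : j ≤ i) a b, Rel A₁ j a B₁ b → Rel A₂ j (f.1 j hj a) B₂ (g.1 j hj b) :=
  iff_of_eq (Rel.eq_7 i B y A₁.1 A₂.1 ⟨A₁.2, A₂.2⟩ f)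

theorem mu_def {A : Ty 1} {h : (Ty.mu A : Ty 0).WF} {x y} :
    Rel (.mu A h) i x B y ↔
      ∃ (B₁ : Ty 1) (h₁ : (Ty.mu B₁ : Ty 0).WF) (e : B = CTy.mu B₁ h₁),
        Rel (.unfolding A h) i ((unfoldHom A h).app i x) (.unfolding B₁ h₁)
          ((unfoldHom B₁ h₁).app i (e ▸ y : (CTy.mu B₁ h₁).den.obj i)) :=
  iff_of_eq (Rel.eq_8 i B y A h x)

theorem later_zero_def {A : CTy} {x y} : Rel A.later 0 x B y ↔ ∃ B₁ : CTy, B = B₁.later :=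
  iff_of_eq (Rel.eq_9 B A.1 A.2 x y)

theorem later_succ_def {A : CTy} {x : A.den.obj i} {y} :
    Rel A.later (i + 1) x B y ↔ ∃ (B₁ : CTy) (e : B = B₁.later),
      Rel A i x B₁ (e ▸ y : B₁.later.den.obj (i + 1)) :=
  iff_of_eq (Rel.eq_10 B A.1 A.2 i x y)

theorem box_def {A : CTy} {x : Hom Tree.one A.den} {y} :
    Rel A.box i x B y ↔ ∃ (B₁ : CTy) (e : B = B₁.box),
      let y : Hom Tree.one B₁.den := (e ▸ y : B₁.box.den.obj i)
      ∀ j, Rel A j (x.app j PUnit.unit) B₁ (y.app j PUnit.unit) :=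
  iff_of_eq (Rel.eq_11 i B y A.1 A.2 x)

end

/-! ### Elements of types with the same outermost type former -/

theorem nat_iff {i : ℕ} {x y : ℕ} : Rel .nat i x .nat y ↔ x = y := by
  exact nat_def.trans ⟨fun ⟨_, h⟩ => h, fun h => ⟨rfl, h⟩⟩

theorem one {i : ℕ} {x y : PUnit} : Rel .one i x .one y := by
  exact one_def.2 rfl

/-- Injectivity of the type former identifies the components provided by the clause with the given
ones; the remaining cast is along an equation of a type with itself and vanishes. The other
equivalences of this kind hold for the same reason. -/
theorem prod_iff {A₁ A₂ B₁ B₂ : CTy} {i : ℕ} {x : (A₁.den.prod A₂.den).obj i}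
    {y : (B₁.den.prod B₂.den).obj i} :
    Rel (A₁.prod A₂) i x (B₁.prod B₂) y ↔ Rel A₁ i x.1 B₁ y.1 ∧ Rel A₂ i x.2 B₂ y.2 := by
  refine prod_def.trans ⟨?_, fun h => ⟨B₁, B₂, rfl, h⟩⟩
  rintro ⟨B₁', B₂', e, h⟩
  obtain ⟨rfl, rfl⟩ := CTy.prod_inj e
  exact h

theorem sum_iff {A₁ A₂ B₁ B₂ : CTy} {i : ℕ} {x : (A₁.den.sum A₂.den).obj i}
    {y : (B₁.den.sum B₂.den).obj i} :
    Rel (A₁.sum A₂) i x (B₁.sum B₂) y ↔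
      (∃ a b, x = Sum.inl a ∧ y = Sum.inl b ∧ Rel A₁ i a B₁ b) ∨
        ∃ a b, x = Sum.inr a ∧ y = Sum.inr b ∧ Rel A₂ i a B₂ b := by
  refine sum_def.trans ⟨?_, fun h => ⟨B₁, B₂, rfl, h⟩⟩
  rintro ⟨B₁', B₂', e, h⟩
  obtain ⟨rfl, rfl⟩ := CTy.sum_inj e
  exact h

theorem arr_iff {A₁ A₂ B₁ B₂ : CTy} {i : ℕ} {f : (A₁.den.exp A₂.den).obj i}
    {g : (B₁.den.exp B₂.den).obj i} :
    Rel (A₁.arr A₂) i f (B₁.arr B₂) g ↔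
      ∀ j (hj : j ≤ i) a b, Rel A₁ j a B₁ b → Rel A₂ j (f.1 j hj a) B₂ (g.1 j hj b) := by
  refine arr_def.trans ⟨?_, fun h => ⟨B₁, B₂, rfl, h⟩⟩
  rintro ⟨B₁', B₂', e, h⟩
  obtain ⟨rfl, rfl⟩ := CTy.arr_inj e
  exact h

theorem mu_iff {A B : Ty 1} {h : (Ty.mu A : Ty 0).WF} {h' : (Ty.mu B : Ty 0).WF} {i : ℕ}
    {x : (CTy.mu A h).den.obj i} {y : (CTy.mu B h').den.obj i} :
    Rel (.mu A h) i x (.mu B h') y ↔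
      Rel (.unfolding A h) i ((unfoldHom A h).app i x)
        (.unfolding B h') ((unfoldHom B h').app i y) := by
  refine mu_def.trans ⟨?_, fun h => ⟨B, h', rfl, h⟩⟩
  rintro ⟨B', _, e, h⟩
  obtain rfl := CTy.mu_inj e
  exact h

theorem later_zero {A B : CTy} {x : A.den.later.obj 0} {y : B.den.later.obj 0} :
    Rel A.later 0 x B.later y := by
  exact later_zero_def.2 ⟨B, rfl⟩

theorem later_succ_iff {A B : CTy} {i : ℕ} {x : A.den.obj i} {y : B.den.obj i} :
    Rel A.later (i + 1) x B.later y ↔ Rel A i x B y := by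
  refine later_succ_def.trans ⟨?_, fun h => ⟨B, rfl, h⟩⟩
  rintro ⟨B', e, h⟩
  obtain rfl := CTy.later_inj e
  exact h

theorem box_iff {A B : CTy} {i : ℕ} {x : Hom Tree.one A.den} {y : Hom Tree.one B.den} :
    Rel A.box i x B.box y ↔ ∀ j, Rel A j (x.app j PUnit.unit) B (y.app j PUnit.unit) := by
  refine box_def.trans ⟨?_, fun h => ⟨B, rfl, h⟩⟩
  rintro ⟨B', e, h⟩
  obtain rfl := CTy.box_inj e
  exact h

/-! ### The outermost type formers agree -/

theorem nat_inv {i : ℕ} {x B y} (h : Rel .nat i x B y) : B = .nat := by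
  exact (nat_def.1 h).1

theorem one_inv {i : ℕ} {x B y} (h : Rel .one i x B y) : B = .one := by
  exact one_def.1 h

theorem prod_inv {A₁ A₂ : CTy} {i : ℕ} {x B y} (h : Rel (A₁.prod A₂) i x B y) :
    ∃ B₁ B₂ : CTy, B = B₁.prod B₂ := by
  obtain ⟨B₁, B₂, e, -⟩ := prod_def.1 h
  exact ⟨B₁, B₂, e⟩

theorem sum_inv {A₁ A₂ : CTy} {i : ℕ} {x B y} (h : Rel (A₁.sum A₂) i x B y) :
    ∃ B₁ B₂ : CTy, B = B₁.sum B₂ := by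
  obtain ⟨B₁, B₂, e, -⟩ := sum_def.1 h
  exact ⟨B₁, B₂, e⟩

theorem arr_inv {A₁ A₂ : CTy} {i : ℕ} {x B y} (h : Rel (A₁.arr A₂) i x B y) :
    ∃ B₁ B₂ : CTy, B = B₁.arr B₂ := by
  obtain ⟨B₁, B₂, e, -⟩ := arr_def.1 h
  exact ⟨B₁, B₂, e⟩

theorem mu_inv {A : Ty 1} {hA : (Ty.mu A : Ty 0).WF} {i : ℕ} {x B y}
    (h : Rel (.mu A hA) i x B y) : ∃ B₁ h₁, B = .mu B₁ h₁ := by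
  obtain ⟨B₁, h₁, e, -⟩ := mu_def.1 h
  exact ⟨B₁, h₁, e⟩

theorem later_inv {A : CTy} {i : ℕ} {x B y} (h : Rel A.later i x B y) :
    ∃ B₁ : CTy, B = B₁.later := by
  cases i with
  | zero => exact later_zero_def.1 h
  | succ i =>
    obtain ⟨B₁, e, -⟩ := later_succ_def.1 h
    exact ⟨B₁, e⟩

theorem box_inv {A : CTy} {i : ℕ} {x B y} (h : Rel A.box i x B y) : ∃ B₁ : CTy, B = B₁.box := by
  obtain ⟨B₁, e, -⟩ := box_def.1 h
  exact ⟨B₁, e⟩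

/-! ### Properties of the relation -/

/-- Both directions are needed together: at an arrow type, reflexivity on the domain supplies
related arguments, while the converse on the domain turns related arguments into equal ones. At a
recursive type the unfolding map is injective. -/
theorem iff_eq (A : CTy) (i : ℕ) : ∀ x y, Rel A i x A y ↔ x = y := by
  induction A, i using CTy.stage_induction with
  | nat i => exact fun x y => nat_iff
  | one i => exact fun x y => ⟨fun _ => rfl, fun _ => one⟩
  | zero i => exact fun x => Empty.elim x
  | prod A B i ihA ihB =>
    exact fun x y => prod_iff.trans (((ihA _ _).and (ihB _ _)).trans Prod.ext_iff.symm)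
  | sum A B i ihA ihB =>
    refine fun x y => sum_iff.trans ⟨?_, ?_⟩
    · rintro (⟨a, b, rfl, rfl, h⟩ | ⟨a, b, rfl, rfl, h⟩)
      · exact congrArg Sum.inl ((ihA a b).1 h)
      · exact congrArg Sum.inr ((ihB a b).1 h)
    · rintro rfl
      match x with
      | Sum.inl a => exact Or.inl ⟨a, a, rfl, rfl, (ihA a a).2 rfl⟩
      | Sum.inr a => exact Or.inr ⟨a, a, rfl, rfl, (ihB a a).2 rfl⟩
  | arr A B i ihA ihB =>
    refine fun f g => arr_iff.trans ⟨fun h => Subtype.ext ?_, ?_⟩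
    · funext j hj a
      exact (ihB j hj _ _).1 (h j hj a a ((ihA j hj a a).2 rfl))
    · rintro rfl j hj a b hab
      rw [(ihA j hj a b).1 hab, ihB j hj]
  | mu A h i ih =>
    exact fun x y => mu_iff.trans <| (ih _ _).trans
      (Function.LeftInverse.injective (foldHom_unfoldHom A h i)).eq_iff
  | later_zero A => exact fun x y => ⟨fun _ => rfl, fun _ => later_zero⟩
  | later_succ A i ih => exact fun x y => later_succ_iff.trans (ih x y)
  | box A i ih =>
    refine fun x y => box_iff.trans ⟨fun h => Hom.ext ?_, ?_⟩
    · funext j _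
      exact (ih j _ _).1 (h j)
    · rintro rfl j
      exact (ih j _ _).2 rfl

/-- Related elements have related restrictions. -/
theorem restrict (A : CTy) (i : ℕ) : ∀ (B : CTy) x y,
    Rel A (i + 1) x B y → Rel A i (A.den.r i x) B (B.den.r i y) := by
  induction A, i using CTy.stage_induction with
  | nat i =>
    intro B x y h
    obtain rfl := h.nat_inv
    exact nat_iff.2 (nat_iff.1 h)
  | one i =>
    intro B x y h
    obtain rfl := h.one_inv
    exact one
  | zero i => exact fun _ x => Empty.elim x
  | prod A A' i ihA ihB =>
    intro B x y h
    obtain ⟨B₁, B₂, rfl⟩ := h.prod_inv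
    exact prod_iff.2 ((prod_iff.1 h).imp (ihA _ _ _) (ihB _ _ _))
  | sum A A' i ihA ihB =>
    intro B x y h
    obtain ⟨B₁, B₂, rfl⟩ := h.sum_inv
    refine sum_iff.2 ?_
    rcases sum_iff.1 h with ⟨a, b, rfl, rfl, hab⟩ | ⟨a, b, rfl, rfl, hab⟩
    · exact Or.inl ⟨_, _, rfl, rfl, ihA _ _ _ hab⟩
    · exact Or.inr ⟨_, _, rfl, rfl, ihB _ _ _ hab⟩
  | arr A A' i ihA ihB =>
    intro B x y h
    obtain ⟨B₁, B₂, rfl⟩ := h.arr_inv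
    -- The relation for functions already covers all smaller stages, so no induction hypothesis is
    -- needed.
    exact arr_iff.2 fun j hj => arr_iff.1 h j (Nat.le_succ_of_le hj)
  | mu A hA i ih =>
    intro B x y h
    obtain ⟨B₁, h₁, rfl⟩ := h.mu_inv
    have := ih _ _ _ (mu_iff.1 h)
    -- The unfolding isomorphisms are arrows, so they commute with restriction.
    rw [← (unfoldHom _ _).nat, ← (unfoldHom _ _).nat] at this
    exact mu_iff.2 this
  | later_zero A =>
    intro B x y h
    obtain ⟨B₁, rfl⟩ := h.later_inv
    exact later_zero
  | later_succ A i ih =>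
    intro B x y h
    obtain ⟨B₁, rfl⟩ := h.later_inv
    exact later_succ_iff.2 (ih _ _ _ (later_succ_iff.1 h))
  | box A i ih =>
    intro B x y h
    obtain ⟨B₁, rfl⟩ := h.box_inv
    exact box_iff.2 (box_iff.1 h)

theorem res {A B : CTy} {i j : ℕ} (h : j ≤ i) {x y} (hxy : Rel A i x B y) :
    Rel A j (A.den.res h x) B (B.den.res h y) := by
  induction i, h using Nat.le_induction with
  | base => rwa [Tree.res_self, Tree.res_self]
  | succ i h ih =>
    rw [Tree.res_succ _ h, Tree.res_succ _ h]
    exact ih (restrict _ _ _ _ _ hxy)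

/-- Elements of constant types are related if their restrictions are. -/
theorem of_restrict (A : CTy) (i : ℕ) : ∀ (B : CTy) x y, A.Constant → B.Constant →
    Rel A i (A.den.r i x) B (B.den.r i y) → Rel A (i + 1) x B y := by
  induction A, i using CTy.stage_induction with
  | nat i =>
    intro B x y _ _ h
    obtain rfl := h.nat_inv
    exact nat_iff.2 (nat_iff.1 h)
  | one i =>
    intro B x y _ _ h
    obtain rfl := h.one_inv
    exact one
  | zero i => exact fun _ x => Empty.elim x
  | prod A A' i ihA ihB =>
    intro B x y hA hB h
    obtain ⟨B₁, B₂, rfl⟩ := h.prod_inv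
    exact prod_iff.2 ((prod_iff.1 h).imp (ihA _ _ _ hA.1 hB.1) (ihB _ _ _ hA.2 hB.2))
  | sum A A' i ihA ihB =>
    intro B x y hA hB h
    obtain ⟨B₁, B₂, rfl⟩ := h.sum_inv
    refine sum_iff.2 ?_
    -- Restriction preserves the side of a sum, so the mixed cases contradict the relation between
    -- the restrictions.
    match x, y with
    | Sum.inl a, Sum.inl b =>
      rcases sum_iff.1 h with ⟨_, _, e, e', h⟩ | ⟨_, _, e, e', h⟩
      · cases Sum.inl_injective e
        cases Sum.inl_injective e'
        exact Or.inl ⟨_, _, rfl, rfl, ihA _ _ _ hA.1 hB.1 h⟩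
      · exact (Sum.inl_ne_inr e).elim
    | Sum.inr a, Sum.inr b =>
      rcases sum_iff.1 h with ⟨_, _, e, e', h⟩ | ⟨_, _, e, e', h⟩
      · exact (Sum.inr_ne_inl e).elim
      · cases Sum.inr_injective e
        cases Sum.inr_injective e'
        exact Or.inr ⟨_, _, rfl, rfl, ihB _ _ _ hA.2 hB.2 h⟩
    | Sum.inl a, Sum.inr b =>
      rcases sum_iff.1 h with ⟨_, _, e, e', h⟩ | ⟨_, _, e, e', h⟩
      · exact (Sum.inr_ne_inl e').elim
      · exact (Sum.inl_ne_inr e).elim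
    | Sum.inr a, Sum.inl b =>
      rcases sum_iff.1 h with ⟨_, _, e, e', h⟩ | ⟨_, _, e, e', h⟩
      · exact (Sum.inr_ne_inl e).elim
      · exact (Sum.inl_ne_inr e').elim
  | arr A A' i ihA ihB =>
    intro B f g hA hB h
    obtain ⟨B₁, B₂, rfl⟩ := h.arr_inv
    refine arr_iff.2 fun j hj a b hab => ?_
    rcases Nat.lt_or_ge i j with hij | hij
    · obtain rfl : j = i + 1 := le_antisymm hj hij
      refine ihB i le_rfl _ _ _ hA.2 hB.2 ?_
      -- At the new top stage the arguments are restricted to stage `i`, where the functions are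
      -- known to preserve the relation. By compatibility with restriction the results are the
      -- restrictions of the values at stage `i + 1`, and these are lifted by constancy of the
      -- codomains.
      have := arr_iff.1 h i le_rfl _ _ (restrict _ _ _ _ _ hab)
      exact Eq.mp (congrArg₂ (fun u v => Rel A' i u B₂ v) (f.2 i le_rfl a) (g.2 i le_rfl b)) this
    · exact arr_iff.1 h j hij a b hab
  | mu A hμ i ih =>
    intro B x y hA hB h
    obtain ⟨B₁, h₁, rfl⟩ := h.mu_inv
    refine mu_iff.2 (ih _ _ _ (Ty.constant_unfolding hA) (Ty.constant_unfolding hB) ?_)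
    rw [← (unfoldHom _ _).nat, ← (unfoldHom _ _).nat]
    exact mu_iff.1 h
  | later_zero A => exact fun _ _ _ hA => hA.elim
  | later_succ A i ih => exact fun _ _ _ hA => hA.elim
  | box A i ih =>
    intro B x y _ _ h
    obtain ⟨B₁, rfl⟩ := h.box_inv
    exact box_iff.2 (box_iff.1 h)

theorem of_res {A B : CTy} (hA : A.Constant) (hB : B.Constant) {i j : ℕ} (h : j ≤ i) {x y}
    (hxy : Rel A j (A.den.res h x) B (B.den.res h y)) : Rel A i x B y := by
  induction i, h using Nat.le_induction with
  | base => rwa [Tree.res_self, Tree.res_self] at hxy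
  | succ i h ih =>
    rw [Tree.res_succ _ h, Tree.res_succ _ h] at hxy
    exact of_restrict _ _ _ _ _ hA hB (ih hxy)

/-- A change of stage is characterised by the restriction to the first stage. The relation therefore
descends from `i` to the first stage and climbs back up to `j`. -/
theorem move {A B : CTy} (hA : A.Constant) (hB : B.Constant) (i j : ℕ) {x y}
    (h : Rel A i x B y) : Rel A j (hA.isConst.move i j x) B (hB.isConst.move i j y) := by
  refine of_res hA hB (Nat.zero_le j) ?_
  rw [Tree.IsConst.res_move, Tree.IsConst.res_move]
  exact h.res _

end Rel

/-! ## Coherence: the interpretation does not depend on the derivation -/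

theorem Tree.pi_res {n : ℕ} (X : Fin n → Tree) {i j : ℕ} (h : j ≤ i) (p : (Tree.pi X).obj i)
    (k : Fin n) : (Tree.pi X).res h p k = (X k).res h (p k) := by
  induction i, h using Nat.le_induction with
  | base => rw [Tree.res_self, Tree.res_self]
  | succ i h ih => rw [Tree.res_succ _ h, Tree.res_succ _ h, ih]

/-- Elements of a constant object are determined by their restrictions to the first stage, and
restriction in a product is componentwise. -/
theorem Tree.IsConst.pi_move {n : ℕ} {X : Fin n → Tree} (h : (Tree.pi X).IsConst)
    (h' : ∀ k, (X k).IsConst) (i j : ℕ) (p : (Tree.pi X).obj i) (k : Fin n) :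
    h.move i j p k = (h' k).move i j (p k) := by
  apply ((h' k).res_zero j).1
  rw [(h' k).res_move, ← Tree.pi_res, h.res_move, Tree.pi_res]

/-! ### Case distinction and splitting of global elements -/

namespace Hom

theorem caseOf_app_inl {G X Y Z : Tree} {f : Hom G (X.sum Y)} (g : Hom (G.prod X) Z)
    (h : Hom (G.prod Y) Z) {i : ℕ} {γ : G.obj i} {a : X.obj i} (e : f.app i γ = Sum.inl a) :
    (caseOf f g h).app i γ = g.app i (γ, a) :=
  congrArg (Sum.elim (fun a => g.app i (γ, a)) fun b => h.app i (γ, b)) e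

theorem caseOf_app_inr {G X Y Z : Tree} {f : Hom G (X.sum Y)} (g : Hom (G.prod X) Z)
    (h : Hom (G.prod Y) Z) {i : ℕ} {γ : G.obj i} {b : Y.obj i} (e : f.app i γ = Sum.inr b) :
    (caseOf f g h).app i γ = h.app i (γ, b) :=
  congrArg (Sum.elim (fun a => g.app i (γ, a)) fun b => h.app i (γ, b)) e

theorem app_of_split_eq_inl {X Y : Tree} {s : Hom Tree.one (X.sum Y)} {a : Hom Tree.one X}
    (h : split s = Sum.inl a) (j : ℕ) : s.app j PUnit.unit = Sum.inl (a.app j PUnit.unit) := by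
  unfold split at h
  split_ifs at h with hs
  cases Sum.inl_injective h
  exact (Sum.inl_getLeft _ _).symm

theorem app_of_split_eq_inr {X Y : Tree} {s : Hom Tree.one (X.sum Y)} {b : Hom Tree.one Y}
    (h : split s = Sum.inr b) (j : ℕ) : s.app j PUnit.unit = Sum.inr (b.app j PUnit.unit) := by
  unfold split at h
  split_ifs at h with hs
  cases Sum.inr_injective h
  exact (Sum.inr_getRight _ _).symm

/-- The first stage already excludes the other side; on the correct side, injectivity of `Sum.inl`
identifies the components stage by stage. -/
theorem split_eq_inl {X Y : Tree} {s : Hom Tree.one (X.sum Y)} {a : Hom Tree.one X}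
    (h : ∀ j, s.app j PUnit.unit = Sum.inl (a.app j PUnit.unit)) : split s = Sum.inl a := by
  rcases hs : split s with a' | b
  · refine congrArg Sum.inl (Hom.ext ?_)
    funext j _
    exact Sum.inl_injective ((app_of_split_eq_inl hs j).symm.trans (h j))
  · exact (Sum.inr_ne_inl ((app_of_split_eq_inr hs 0).symm.trans (h 0))).elim

theorem split_eq_inr {X Y : Tree} {s : Hom Tree.one (X.sum Y)} {b : Hom Tree.one Y}
    (h : ∀ j, s.app j PUnit.unit = Sum.inr (b.app j PUnit.unit)) : split s = Sum.inr b := by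
  rcases hs : split s with a | b'
  · exact (Sum.inl_ne_inr ((app_of_split_eq_inl hs 0).symm.trans (h 0))).elim
  · refine congrArg Sum.inr (Hom.ext ?_)
    funext j _
    exact Sum.inr_injective ((app_of_split_eq_inr hs j).symm.trans (h j))

end Hom

namespace Rel

theorem congr {A B : CTy} {i : ℕ} {x x' y y'} (h : Rel A i x B y) (hx : x' = x) (hy : y' = y) :
    Rel A i x' B y' := by
  rwa [hx, hy]

/-- This is the case of `box⁺` in the fundamental lemma. Relatedness at the first stage forces both
global elements onto the same side, and the other stages then relate their contents. -/
theorem split {A₁ A₂ B₁ B₂ : CTy} {s : Hom Tree.one (A₁.den.sum A₂.den)}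
    {s' : Hom Tree.one (B₁.den.sum B₂.den)}
    (h : ∀ j, Rel (A₁.sum A₂) j (s.app j PUnit.unit) (B₁.sum B₂) (s'.app j PUnit.unit)) (i : ℕ) :
    Rel (A₁.box.sum A₂.box) i (Hom.split s) (B₁.box.sum B₂.box) (Hom.split s') := by
  have H := fun j => sum_iff.1 (h j)
  refine sum_iff.2 ?_
  rcases hs : Hom.split s with a | a <;> rcases hs' : Hom.split s' with b | b
  · refine Or.inl ⟨a, b, hs, hs', box_iff.2 fun j => ?_⟩
    rcases H j with ⟨_, _, e, e', hab⟩ | ⟨_, _, e, -⟩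
    · exact hab.congr (Sum.inl_injective ((Hom.app_of_split_eq_inl hs j).symm.trans e))
        (Sum.inl_injective ((Hom.app_of_split_eq_inl hs' j).symm.trans e'))
    · exact (Sum.inl_ne_inr ((Hom.app_of_split_eq_inl hs j).symm.trans e)).elim
  · rcases H 0 with ⟨_, _, -, e, -⟩ | ⟨_, _, e, -⟩
    · exact (Sum.inr_ne_inl ((Hom.app_of_split_eq_inr hs' 0).symm.trans e)).elim
    · exact (Sum.inl_ne_inr ((Hom.app_of_split_eq_inl hs 0).symm.trans e)).elim
  · rcases H 0 with ⟨_, _, e, -⟩ | ⟨_, _, -, e, -⟩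
    · exact (Sum.inr_ne_inl ((Hom.app_of_split_eq_inr hs 0).symm.trans e)).elim
    · exact (Sum.inl_ne_inr ((Hom.app_of_split_eq_inl hs' 0).symm.trans e)).elim
  · refine Or.inr ⟨a, b, hs, hs', box_iff.2 fun j => ?_⟩
    rcases H j with ⟨_, _, e, -⟩ | ⟨_, _, e, e', hab⟩
    · exact (Sum.inr_ne_inl ((Hom.app_of_split_eq_inr hs j).symm.trans e)).elim
    · exact hab.congr (Sum.inr_injective ((Hom.app_of_split_eq_inr hs j).symm.trans e))
        (Sum.inr_injective ((Hom.app_of_split_eq_inr hs' j).symm.trans e'))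

end Rel

/-- The logical relation between the interpretations of two typing contexts. -/
def Ctx.Rel {n : ℕ} (Γ : Ctx n) (i : ℕ) (γ : Γ.den.obj i) (Γ' : Ctx n) (γ' : Γ'.den.obj i) : Prop :=
  ∀ x, GuardedLambda.Rel (Γ x) i (γ x) (Γ' x) (γ' x)

namespace Ctx.Rel

variable {n : ℕ} {Γ Γ' : Ctx n} {i : ℕ} {γ : Γ.den.obj i} {γ' : Γ'.den.obj i}

theorem cons (h : Γ.Rel i γ Γ' γ') {A A' : CTy} {a a'} (ha : GuardedLambda.Rel A i a A' a') :
    (Γ.cons A).Rel i ((Γ.consHom A).app i (γ, a)) (Γ'.cons A') ((Γ'.consHom A').app i (γ', a')) :=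
  Fin.cases ha h

theorem res (h : Γ.Rel i γ Γ' γ') {j : ℕ} (hj : j ≤ i) :
    Γ.Rel j (Γ.den.res hj γ) Γ' (Γ'.den.res hj γ') :=
  fun x => ((h x).res hj).congr (Tree.pi_res _ hj γ x) (Tree.pi_res _ hj γ' x)

theorem move (h : Γ.Rel i γ Γ' γ') (hΓ : ∀ x, (Γ x).Constant) (hΓ' : ∀ x, (Γ' x).Constant) (j : ℕ) :
    Γ.Rel j ((Ctx.isConst_den hΓ).move i j γ) Γ' ((Ctx.isConst_den hΓ').move i j γ') :=
  fun x => ((h x).move (hΓ x) (hΓ' x) i j).congr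
    (Tree.IsConst.pi_move _ (fun x => (hΓ x).isConst) i j γ x)
    (Tree.IsConst.pi_move _ (fun x => (hΓ' x).isConst) i j γ' x)

end Ctx.Rel

/-- The interpretations of two derivations for the same term are related. -/
theorem Typing.rel {n : ℕ} {Γ : Ctx n} {t : Tm n} {A : CTy} (D : Typing Γ t A) :
    ∀ {Γ' : Ctx n} {A' : CTy} (D' : Typing Γ' t A') (i : ℕ) (γ : Γ.den.obj i) (γ' : Γ'.den.obj i),
      Γ.Rel i γ Γ' γ' → Rel A i (D.den.app i γ) A' (D'.den.app i γ') := by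
  induction D with
  | var x =>
    intro Γ' A' D' i γ γ' h
    cases D' with | var => exact h x
  | zero =>
    intro Γ' A' D' i γ γ' h
    cases D' with | zero => exact Rel.nat_iff.2 rfl
  | succ D ih =>
    intro Γ' A' D' i γ γ' h
    cases D' with | succ D' =>
    exact Rel.nat_iff.2 (congrArg Nat.succ (Rel.nat_iff.1 (ih D' i γ γ' h)))
  | unit =>
    intro Γ' A' D' i γ γ' h
    cases D' with | unit => exact Rel.one
  | pair D₁ D₂ ih₁ ih₂ =>
    intro Γ' A' D' i γ γ' h
    cases D' with | pair D₁' D₂' =>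
    exact Rel.prod_iff.2 ⟨ih₁ D₁' i γ γ' h, ih₂ D₂' i γ γ' h⟩
  | fst D ih =>
    intro Γ' A' D' i γ γ' h
    cases D' with | fst D' =>
    exact (Rel.prod_iff.1 (ih D' i γ γ' h)).1
  | snd D ih =>
    intro Γ' A' D' i γ γ' h
    cases D' with | snd D' =>
    exact (Rel.prod_iff.1 (ih D' i γ γ' h)).2
  | abort D ih =>
    intro Γ' A' D' i γ γ' h
    -- The two result types are arbitrary and need have nothing in common, but this case is vacuous:
    -- the argument would denote an element of the empty set.
    exact Empty.elim (D.den.app i γ)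
  | inl D ih =>
    intro Γ' A' D' i γ γ' h
    cases D' with | inl D' =>
    exact Rel.sum_iff.2 (Or.inl ⟨_, _, rfl, rfl, ih D' i γ γ' h⟩)
  | inr D ih =>
    intro Γ' A' D' i γ γ' h
    cases D' with | inr D' =>
    exact Rel.sum_iff.2 (Or.inr ⟨_, _, rfl, rfl, ih D' i γ γ' h⟩)
  | caseOf D D₁ D₂ ih ih₁ ih₂ =>
    intro Γ' A' D' i γ γ' h
    cases D' with | caseOf D' D₁' D₂' =>
    rcases Rel.sum_iff.1 (ih D' i γ γ' h) with ⟨a, a', e, e', ha⟩ | ⟨a, a', e, e', ha⟩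
    · exact (ih₁ D₁' i _ _ (h.cons ha)).congr (Hom.caseOf_app_inl _ _ e) (Hom.caseOf_app_inl _ _ e')
    · exact (ih₂ D₂' i _ _ (h.cons ha)).congr (Hom.caseOf_app_inr _ _ e) (Hom.caseOf_app_inr _ _ e')
  | lam D ih =>
    intro Γ' A' D' i γ γ' h
    cases D' with | lam D' =>
    exact Rel.arr_iff.2 fun j hj a a' ha => ih D' j _ _ ((h.res hj).cons ha)
  | app D₁ D₂ ih₁ ih₂ =>
    intro Γ' A' D' i γ γ' h
    cases D' with | app D₁' D₂' =>
    exact Rel.arr_iff.1 (ih₁ D₁' i γ γ' h) i le_rfl _ _ (ih₂ D₂' i γ γ' h)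
  | fold hA D ih =>
    intro Γ' A' D' i γ γ' h
    cases D' with | fold hA' D' =>
    -- The clause for `μ` compares unfoldings, and unfolding cancels the folding map.
    exact Rel.mu_iff.2 ((ih D' i γ γ' h).congr (unfoldHom_foldHom _ _ _ _)
      (unfoldHom_foldHom _ _ _ _))
  | unfold hA D ih =>
    intro Γ' A' D' i γ γ' h
    cases D' with | unfold hA' D' =>
    exact Rel.mu_iff.1 (ih D' i γ γ' h)
  | next D ih =>
    intro Γ' A' D' i γ γ' h
    cases D' with | next D' =>
    cases i with
    | zero => exact Rel.later_zero
    -- The value of `next` at stage `i + 1` is the restriction to `i` of the value of the body.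
    | succ i => exact Rel.later_succ_iff.2 (Rel.restrict _ _ _ _ _ (ih D' (i + 1) γ γ' h))
  | prev hΔ D Ds ih ihs =>
    intro Γ' A' D' i γ γ' h
    cases D' with | prev hΔ' D' Ds' =>
    -- The two derivations may type the explicit substitution in different constant contexts;
    -- relatedness is carried from stage `i` to stage `i + 1` in both at once.
    exact Rel.later_succ_iff.1 (ih D' (i + 1) _ _
      (Ctx.Rel.move (fun x => ihs x (Ds' x) i γ γ' h) hΔ hΔ' (i + 1)))
  | lap D₁ D₂ ih₁ ih₂ =>
    intro Γ' A' D' i γ γ' h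
    cases D' with | lap D₁' D₂' =>
    cases i with
    | zero => exact Rel.later_zero
    | succ i =>
      exact Rel.later_succ_iff.2 <| Rel.arr_iff.1
        (Rel.later_succ_iff.1 (ih₁ D₁' (i + 1) γ γ' h)) i le_rfl _ _
        (Rel.later_succ_iff.1 (ih₂ D₂' (i + 1) γ γ' h))
  | box hΔ D Ds ih ihs =>
    intro Γ' A' D' i γ γ' h
    cases D' with | box hΔ' D' Ds' =>
    exact Rel.box_iff.2 fun j => ih D' j _ _
      (Ctx.Rel.move (fun x => ihs x (Ds' x) i γ γ' h) hΔ hΔ' j)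
  | unbox D ih =>
    intro Γ' A' D' i γ γ' h
    cases D' with | unbox D' =>
    exact Rel.box_iff.1 (ih D' i γ γ' h) i
  | boxPlus hΔ D Ds ih ihs =>
    intro Γ' A' D' i γ γ' h
    cases D' with | boxPlus hΔ' D' Ds' =>
    exact Rel.split (fun j => ih D' j _ _
      (Ctx.Rel.move (fun x => ihs x (Ds' x) i γ γ' h) hΔ hΔ' j)) i

/-- Coherence: the interpretation of a typed term does not depend on the derivation. -/
theorem Typing.den_eq {n : ℕ} {Γ : Ctx n} {t : Tm n} {A : CTy} (D D' : Typing Γ t A) :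
    D.den = D'.den := by
  refine Hom.ext ?_
  funext i γ
  exact (Rel.iff_eq A i _ _).1 (D.rel D' i γ γ fun x => (Rel.iff_eq _ i _ _).2 rfl)

/-! ## Substitution -/

namespace Tm

/-- With this, weakening becomes an instance of the substitution lemma and needs no separate
induction. -/
theorem ren_eq_subst {n : ℕ} (t : Tm n) : ∀ {k : ℕ} (ξ : Fin n → Fin k),
    t.ren ξ = t.subst fun x => var (ξ x) := by
  have hl : ∀ {n k : ℕ} (ξ : Fin n → Fin k),
      lift (fun x => var (ξ x)) = fun x => var (Fin.cases 0 (fun x => (ξ x).succ) x) := by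
    intro n k ξ
    funext x
    exact Fin.cases rfl (fun _ => rfl) x
  induction t <;> intros <;> simp_all [ren, subst]

end Tm

theorem Hom.app_res {X Y : Tree} (f : Hom X Y) {i j : ℕ} (h : j ≤ i) (x : X.obj i) :
    f.app j (X.res h x) = Y.res h (f.app i x) := by
  induction i, h using Nat.le_induction with
  | base => rw [Tree.res_self, Tree.res_self]
  | succ i h ih => rw [Tree.res_succ _ h, Tree.res_succ _ h, ih, f.nat]

/-- It suffices to compare both sides at the first stage, where naturality of `f` applies. -/
theorem Hom.app_move {X Y : Tree} (f : Hom X Y) (hX : X.IsConst) (hY : Y.IsConst) (i j : ℕ)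
    (x : X.obj i) : f.app j (hX.move i j x) = hY.move i j (f.app i x) := by
  apply (hY.res_zero j).1
  rw [← f.app_res, hX.res_move, hY.res_move, f.app_res]

/-- The interpretation of a substitution whose terms are typed. -/
noncomputable def substHom {n k : ℕ} {Γ : Ctx n} {Δ : Ctx k} {σ : Fin n → Tm k}
    (Ds : ∀ x, Typing Δ (σ x) (Γ x)) : Hom Δ.den Γ.den :=
  Hom.tuple fun x => (Ds x).den

/-- Weakening by one variable preserves the typings of a term and their interpretations. -/
def Weakens {k : ℕ} (s : Tm k) : Prop :=
  ∀ {Δ : Ctx k} {A : CTy} (B : CTy) (D : Typing Δ s A),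
    ∃ D' : Typing (Δ.cons B) (s.ren Fin.succ) A,
      ∀ i δ b, D'.den.app i ((Δ.consHom B).app i (δ, b)) = D.den.app i δ

theorem weakens_var {k : ℕ} (x : Fin k) : Weakens (.var x) := by
  intro Δ A B D
  cases D with | var =>
  exact ⟨.var (Γ := Δ.cons B) x.succ, fun _ _ _ => rfl⟩

/-- The typing of a lifted substitution. -/
theorem exists_lift {n k : ℕ} {Γ : Ctx n} {Δ : Ctx k} {σ : Fin n → Tm k}
    (hσ : ∀ x, Weakens (σ x)) (Ds : ∀ x, Typing Δ (σ x) (Γ x)) (B : CTy) :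
    ∃ Ds' : ∀ x, Typing (Δ.cons B) (Tm.lift σ x) (Γ.cons B x), ∀ i δ b,
      (substHom Ds').app i ((Δ.consHom B).app i (δ, b))
        = (Γ.consHom B).app i ((substHom Ds).app i δ, b) := by
  choose Ds' h using fun x => hσ x B (Ds x)
  refine ⟨Fin.cases (.var (Γ := Δ.cons B) 0) Ds', fun i δ b => ?_⟩
  funext x
  exact Fin.cases rfl (fun x => h x i δ b) x

/-- Substitution preserves typings and their interpretations, for a class of substitutions that is
closed under lifting. -/
theorem Typing.exists_subst_of_weakens {K : ∀ {k : ℕ}, Tm k → Prop}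
    (hK : ∀ {k : ℕ} {s : Tm k}, K s → Weakens s) (hvar : ∀ {k : ℕ} (x : Fin k), K (.var x))
    (hren : ∀ {k : ℕ} {s : Tm k}, K s → K (s.ren Fin.succ))
    {n : ℕ} {Γ : Ctx n} {t : Tm n} {A : CTy} (D : Typing Γ t A) :
    ∀ {k : ℕ} {Δ : Ctx k} {σ : Fin n → Tm k} (_ : ∀ x, K (σ x)) (Ds : ∀ x, Typing Δ (σ x) (Γ x)),
      ∃ D' : Typing Δ (t.subst σ) A, D'.den = (substHom Ds).comp D.den := by
  have hlift : ∀ {n k : ℕ} {σ : Fin n → Tm k}, (∀ x, K (σ x)) → ∀ x, K (Tm.lift σ x) :=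
    fun h x => Fin.cases (hvar 0) (fun x => hren (h x)) x
  induction D with
  | var x =>
    intro k Δ σ hσ Ds
    exact ⟨Ds x, rfl⟩
  | zero =>
    intro k Δ σ hσ Ds
    exact ⟨.zero, rfl⟩
  | unit =>
    intro k Δ σ hσ Ds
    exact ⟨.unit, rfl⟩
  | succ D ih =>
    intro k Δ σ hσ Ds
    obtain ⟨D', h⟩ := ih hσ Ds
    exact ⟨.succ D', congrArg Hom.succ h⟩
  | fst D ih =>
    intro k Δ σ hσ Ds
    obtain ⟨D', h⟩ := ih hσ Ds
    exact ⟨.fst D', congrArg Hom.fst h⟩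
  | snd D ih =>
    intro k Δ σ hσ Ds
    obtain ⟨D', h⟩ := ih hσ Ds
    exact ⟨.snd D', congrArg Hom.snd h⟩
  | abort D ih =>
    intro k Δ σ hσ Ds
    obtain ⟨D', h⟩ := ih hσ Ds
    exact ⟨.abort D', congrArg Hom.abort h⟩
  | inl D ih =>
    intro k Δ σ hσ Ds
    obtain ⟨D', h⟩ := ih hσ Ds
    exact ⟨.inl D', congrArg Hom.inl h⟩
  | inr D ih =>
    intro k Δ σ hσ Ds
    obtain ⟨D', h⟩ := ih hσ Ds
    exact ⟨.inr D', congrArg Hom.inr h⟩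
  | unbox D ih =>
    intro k Δ σ hσ Ds
    obtain ⟨D', h⟩ := ih hσ Ds
    exact ⟨.unbox D', congrArg Hom.unbox h⟩
  | fold hA D ih =>
    intro k Δ σ hσ Ds
    obtain ⟨D', h⟩ := ih hσ Ds
    exact ⟨.fold hA D', congrArg (Hom.comp · (foldHom _ hA)) h⟩
  | unfold hA D ih =>
    intro k Δ σ hσ Ds
    obtain ⟨D', h⟩ := ih hσ Ds
    exact ⟨.unfold hA D', congrArg (Hom.comp · (unfoldHom _ hA)) h⟩
  | pair D₁ D₂ ih₁ ih₂ =>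
    intro k Δ σ hσ Ds
    obtain ⟨D₁', h₁⟩ := ih₁ hσ Ds
    obtain ⟨D₂', h₂⟩ := ih₂ hσ Ds
    exact ⟨.pair D₁' D₂', congrArg₂ Hom.pair h₁ h₂⟩
  | app D₁ D₂ ih₁ ih₂ =>
    intro k Δ σ hσ Ds
    obtain ⟨D₁', h₁⟩ := ih₁ hσ Ds
    obtain ⟨D₂', h₂⟩ := ih₂ hσ Ds
    exact ⟨.app D₁' D₂', congrArg₂ Hom.ap h₁ h₂⟩
  | next D ih =>
    intro k Δ σ hσ Ds
    obtain ⟨D', h⟩ := ih hσ Ds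
    refine ⟨.next D', (congrArg Hom.next h).trans (Hom.ext ?_)⟩
    funext i
    -- `Hom.next` is defined by cases on the stage, so the two sides agree by computation only once
    -- the stage is zero or a successor.
    cases i with
    | zero => rfl
    | succ i =>
      funext δ
      exact congrArg (Tree.r _ i) rfl
  | lap D₁ D₂ ih₁ ih₂ =>
    intro k Δ σ hσ Ds
    obtain ⟨D₁', h₁⟩ := ih₁ hσ Ds
    obtain ⟨D₂', h₂⟩ := ih₂ hσ Ds
    refine ⟨.lap D₁' D₂', (congrArg₂ Hom.lap h₁ h₂).trans (Hom.ext ?_)⟩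
    funext i
    cases i <;> rfl
  | caseOf D D₁ D₂ ih ih₁ ih₂ =>
    intro k Δ σ hσ Ds
    obtain ⟨D', h⟩ := ih hσ Ds
    obtain ⟨Ds₁, hs₁⟩ := exists_lift (fun x => hK (hσ x)) Ds _
    obtain ⟨Ds₂, hs₂⟩ := exists_lift (fun x => hK (hσ x)) Ds _
    obtain ⟨D₁', h₁⟩ := ih₁ (hlift hσ) Ds₁
    obtain ⟨D₂', h₂⟩ := ih₂ (hlift hσ) Ds₂
    refine ⟨.caseOf D' D₁' D₂', Hom.ext ?_⟩
    funext i δ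
    have e := congrArg (fun f => Hom.app f i δ) h
    rcases hd : D.den.app i ((substHom Ds).app i δ) with a | a
    · refine (Hom.caseOf_app_inl _ _ (e.trans hd)).trans <|
        Eq.trans ?_ (Hom.caseOf_app_inl (f := D.den) _ _ hd).symm
      exact (congrArg (fun f => Hom.app f i _) h₁).trans (congrArg (D₁.den.app i) (hs₁ i δ a))
    · refine (Hom.caseOf_app_inr _ _ (e.trans hd)).trans <|
        Eq.trans ?_ (Hom.caseOf_app_inr (f := D.den) _ _ hd).symm
      exact (congrArg (fun f => Hom.app f i _) h₂).trans (congrArg (D₂.den.app i) (hs₂ i δ a))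
  | lam D ih =>
    intro k Δ σ hσ Ds
    obtain ⟨Ds', hs⟩ := exists_lift (fun x => hK (hσ x)) Ds _
    obtain ⟨D', h⟩ := ih (hlift hσ) Ds'
    refine ⟨.lam D', Hom.ext ?_⟩
    funext i δ
    refine Subtype.ext ?_
    funext j hj a
    refine (congrArg (fun f => Hom.app f j _) h).trans (congrArg (D.den.app j) ?_)
    refine (hs j (Δ.den.res hj δ) a).trans ?_
    -- An abstraction restricts its environment before use, and the arrow of the substitution
    -- commutes with restriction.
    exact congrArg (fun γ => (Ctx.consHom _ _).app j (γ, a)) ((substHom Ds).app_res hj δ)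
  | prev hΔ D Ds₀ ih ihs =>
    intro k Δ σ hσ Ds
    choose Ds' h using fun x => ihs x hσ Ds
    -- The body has only the variables bound by the explicit substitution, so its derivation is
    -- reused and only the substituted terms change.
    exact ⟨.prev hΔ D Ds', congrArg (fun f => Hom.prev _ D.den (Hom.tuple f)) (funext h)⟩
  | box hΔ D Ds₀ ih ihs =>
    intro k Δ σ hσ Ds
    choose Ds' h using fun x => ihs x hσ Ds
    exact ⟨.box hΔ D Ds', congrArg (fun f => Hom.box _ D.den (Hom.tuple f)) (funext h)⟩
  | boxPlus hΔ D Ds₀ ih ihs =>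
    intro k Δ σ hσ Ds
    choose Ds' h using fun x => ihs x hσ Ds
    exact ⟨.boxPlus hΔ D Ds', congrArg (fun f => Hom.boxPlus _ D.den (Hom.tuple f)) (funext h)⟩

/-- Substitution under a binder needs weakening, and weakening is itself a substitution. The circle
is broken by applying `Typing.exists_subst_of_weakens` first to the class of variables, whose
weakening is immediate; this yields weakening for all terms and hence the lemma for all
substitutions. -/
theorem weakens {k : ℕ} (s : Tm k) : Weakens s := by
  intro Δ A B D
  obtain ⟨D', h⟩ := D.exists_subst_of_weakens (K := fun s => ∃ x, s = .var x)
    (fun ⟨x, e⟩ => e ▸ weakens_var x) (fun x => ⟨x, rfl⟩)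
    (by rintro _ _ ⟨x, rfl⟩; exact ⟨x.succ, rfl⟩)
    (fun x => ⟨x.succ, rfl⟩) (fun x => .var (Γ := Δ.cons B) x.succ)
  rw [Tm.ren_eq_subst]
  exact ⟨D', fun i δ b => congrArg (fun f => Hom.app f i _) h⟩

/-- Substitution preserves typings and is interpreted by composition. -/
theorem Typing.exists_subst {n k : ℕ} {Γ : Ctx n} {Δ : Ctx k} {σ : Fin n → Tm k} {t : Tm n}
    {A : CTy} (D : Typing Γ t A) (Ds : ∀ x, Typing Δ (σ x) (Γ x)) :
    ∃ D' : Typing Δ (t.subst σ) A, D'.den = (substHom Ds).comp D.den :=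
  D.exists_subst_of_weakens (K := fun _ => True) (fun _ => weakens _) (fun _ => trivial)
    (fun _ => trivial) (fun _ => trivial) Ds

/-! ## Soundness of reduction -/

/-- All typings of the closed term `t` are typings of `u`, with the same interpretation. -/
def Sound (t u : Tm 0) : Prop :=
  ∀ (A : CTy) (D : Typing Ctx.nil t A), ∃ D' : Typing Ctx.nil u A, D.den = D'.den

namespace Typing

/-! ### Inversion -/

/-- The type formers on `CTy` are functions and not constructors, so case analysis cannot unify the
type of the derivation. The type is replaced by a variable `C` with an equation, and injectivity of
the former recovers its components. The later inversions use the same device. -/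
theorem pair_inv {n : ℕ} {Γ : Ctx n} {t₁ t₂ : Tm n} {A B : CTy}
    (D : Typing Γ (.pair t₁ t₂) (A.prod B)) :
    ∃ (D₁ : Typing Γ t₁ A) (D₂ : Typing Γ t₂ B), D = .pair D₁ D₂ := by
  suffices H : ∀ C (D : Typing Γ (.pair t₁ t₂) C) (e : C = A.prod B),
      ∃ D₁ D₂, e ▸ D = .pair D₁ D₂ from
    H _ D rfl
  intro C D hC
  cases D with | pair D₁ D₂ =>
  obtain ⟨rfl, rfl⟩ := CTy.prod_inj hC
  exact ⟨D₁, D₂, rfl⟩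

theorem inl_inv {n : ℕ} {Γ : Ctx n} {t : Tm n} {A B : CTy} (D : Typing Γ (.inl t) (A.sum B)) :
    ∃ D₁ : Typing Γ t A, D = .inl D₁ := by
  suffices H : ∀ C (D : Typing Γ (.inl t) C) (e : C = A.sum B), ∃ D₁, e ▸ D = .inl D₁ from
    H _ D rfl
  intro C D hC
  cases D with | inl D₁ =>
  obtain ⟨rfl, rfl⟩ := CTy.sum_inj hC
  exact ⟨D₁, rfl⟩

theorem inr_inv {n : ℕ} {Γ : Ctx n} {t : Tm n} {A B : CTy} (D : Typing Γ (.inr t) (A.sum B)) :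
    ∃ D₁ : Typing Γ t B, D = .inr D₁ := by
  suffices H : ∀ C (D : Typing Γ (.inr t) C) (e : C = A.sum B), ∃ D₁, e ▸ D = .inr D₁ from
    H _ D rfl
  intro C D hC
  cases D with | inr D₁ =>
  obtain ⟨rfl, rfl⟩ := CTy.sum_inj hC
  exact ⟨D₁, rfl⟩

theorem lam_inv {n : ℕ} {Γ : Ctx n} {t : Tm (n + 1)} {A B : CTy}
    (D : Typing Γ (.lam t) (A.arr B)) : ∃ D₁ : Typing (Γ.cons A) t B, D = .lam D₁ := by
  suffices H : ∀ C (D : Typing Γ (.lam t) C) (e : C = A.arr B), ∃ D₁, e ▸ D = .lam D₁ from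
    H _ D rfl
  intro C D hC
  cases D with | lam D₁ =>
  obtain ⟨rfl, rfl⟩ := CTy.arr_inj hC
  exact ⟨D₁, rfl⟩

theorem fold_inv {n : ℕ} {Γ : Ctx n} {t : Tm n} {A : Ty 1} {h : (Ty.mu A : Ty 0).WF}
    (D : Typing Γ (.fold t) (.mu A h)) : ∃ D₁ : Typing Γ t (.unfolding A h), D = .fold h D₁ := by
  suffices H : ∀ C (D : Typing Γ (.fold t) C) (e : C = CTy.mu A h), ∃ D₁, e ▸ D = .fold h D₁ from
    H _ D rfl
  intro C D hC
  cases D with | fold _ D₁ =>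
  obtain rfl := CTy.mu_inj hC
  exact ⟨D₁, rfl⟩

theorem next_inv {n : ℕ} {Γ : Ctx n} {t : Tm n} {A : CTy} (D : Typing Γ (.next t) A.later) :
    ∃ D₁ : Typing Γ t A, D = .next D₁ := by
  suffices H : ∀ C (D : Typing Γ (.next t) C) (e : C = A.later), ∃ D₁, e ▸ D = .next D₁ from
    H _ D rfl
  intro C D hC
  cases D with | next D₁ =>
  obtain rfl := CTy.later_inj hC
  exact ⟨D₁, rfl⟩

theorem box_inv {n m : ℕ} {Γ : Ctx n} {ts : Fin m → Tm n} {t : Tm m} {A : CTy}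
    (D : Typing Γ (.box ts t) A.box) :
    ∃ (Δ : Ctx m) (hΔ : ∀ i, (Δ i).Constant) (D₁ : Typing Δ t A) (Ds : ∀ i, Typing Γ (ts i) (Δ i)),
      D = .box hΔ D₁ Ds := by
  suffices H : ∀ C (D : Typing Γ (.box ts t) C) (e : C = A.box),
      ∃ (Δ : Ctx m) (hΔ : ∀ i, (Δ i).Constant) (D₁ : Typing Δ t A) (Ds : ∀ i, Typing Γ (ts i) (Δ i)),
      e ▸ D = .box hΔ D₁ Ds from
    H _ D rfl
  intro C D hC
  cases D with | box hΔ D₁ Ds =>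
  obtain rfl := CTy.box_inj hC
  exact ⟨_, hΔ, D₁, Ds, rfl⟩

end Typing

theorem constant_nil (i : Fin 0) : (Ctx.nil i).Constant := i.elim0

/-- Global elements of constant objects do not depend on the stage. -/
theorem substHom_move {m : ℕ} {Δ : Ctx m} {ts : Fin m → Tm 0}
    (Ds : ∀ x, Typing Ctx.nil (ts x) (Δ x)) (hΔ : ∀ i, (Δ i).Constant) {i j : ℕ}
    (δ : Ctx.nil.den.obj i) (δ' : Ctx.nil.den.obj j) :
    (Ctx.isConst_den hΔ).move i j ((substHom Ds).app i δ) = (substHom Ds).app j δ' := by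
  -- The empty context is a constant object with one element at every stage, so the change of stage
  -- can be performed there, where it has no effect.
  rw [← (substHom Ds).app_move (Ctx.isConst_den constant_nil)]
  exact congrArg _ (funext fun x => x.elim0)

theorem Typing.exists_inst {t : Tm 1} {s : Tm 0} {A B : CTy} (D : Typing (Ctx.nil.cons A) t B)
    (D₁ : Typing Ctx.nil s A) : ∃ D' : Typing Ctx.nil (t.subst fun _ => s) B, ∀ i γ,
      D'.den.app i γ = D.den.app i ((Ctx.nil.consHom A).app i (γ, D₁.den.app i γ)) := by
  obtain ⟨D', h⟩ := D.exists_subst (σ := fun _ => s)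
    (Fin.cases (motive := fun x => Typing Ctx.nil s (Ctx.nil.cons A x)) D₁ fun x => x.elim0)
  refine ⟨D', fun i γ => ?_⟩
  rw [h]
  refine congrArg (D.den.app i) (funext fun x => ?_)
  exact Fin.cases rfl (fun x => x.elim0) x

/-! ### Soundness of the reduction rules and their closure under contexts -/

theorem Rule.sound {t u : Tm 0} (h : Rule t u) : Sound t u := by
  intro A D
  cases h with
  | fst_pair t₁ t₂ =>
    cases D with | fst D =>
    obtain ⟨D₁, D₂, rfl⟩ := D.pair_inv
    exact ⟨D₁, rfl⟩
  | snd_pair t₁ t₂ =>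
    cases D with | snd D =>
    obtain ⟨D₁, D₂, rfl⟩ := D.pair_inv
    exact ⟨D₂, rfl⟩
  | case_inl t t₁ t₂ =>
    cases D with | caseOf D D₁ D₂ =>
    obtain ⟨D, rfl⟩ := D.inl_inv
    obtain ⟨D', h⟩ := D₁.exists_inst D
    exact ⟨D', Hom.ext (funext fun i => funext fun γ => (h i γ).symm)⟩
  | case_inr t t₁ t₂ =>
    cases D with | caseOf D D₁ D₂ =>
    obtain ⟨D, rfl⟩ := D.inr_inv
    obtain ⟨D', h⟩ := D₂.exists_inst D
    exact ⟨D', Hom.ext (funext fun i => funext fun γ => (h i γ).symm)⟩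
  | beta t₁ t₂ =>
    cases D with | app D₁ D₂ =>
    obtain ⟨D₁, rfl⟩ := D₁.lam_inv
    obtain ⟨D', h⟩ := D₁.exists_inst D₂
    refine ⟨D', Hom.ext (funext fun i => funext fun γ => ((h i γ).trans ?_).symm)⟩
    -- Application uses the abstraction at the current stage, so the environment is restricted from
    -- `i` to `i`, which is the identity.
    exact congrArg (fun γ' => D₁.den.app i ((Ctx.nil.consHom _).app i (γ', D₂.den.app i γ)))
      (Tree.res_self _ i γ).symm
  | unfold_fold t =>
    cases D with | unfold hA D =>
    obtain ⟨D, rfl⟩ := D.fold_inv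
    exact ⟨D, Hom.ext (funext fun i => funext fun γ => unfoldHom_foldHom _ _ i _)⟩
  | prev_subst hm ts t =>
    cases D with | prev hΔ D Ds =>
    obtain ⟨D', h⟩ := D.exists_subst Ds
    refine ⟨.prev constant_nil D' fun x => x.elim0, Hom.ext (funext fun i => funext fun γ => ?_)⟩
    exact (congrArg (D.den.app (i + 1)) (substHom_move Ds hΔ _ _)).trans
      (congrArg (fun f => Hom.app f (i + 1) _) h).symm
  | prev_next t =>
    cases D with | @prev _ _ _ Δ _ _ _ hΔ D Ds =>
    -- There is only one context of length zero.
    obtain rfl : Δ = Ctx.nil := Subsingleton.elim _ _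
    obtain ⟨D, rfl⟩ := D.next_inv
    refine ⟨D, Hom.ext (funext fun i => funext fun γ => ?_)⟩
    -- `prev` evaluates at stage `i + 1` and `next` restricts back to `i`; by naturality this is the
    -- value at `i` itself.
    refine (D.den.nat i _).symm.trans (congrArg (D.den.app i) (funext fun x => x.elim0))
  | lap_next t₁ t₂ =>
    cases D with | lap D₁ D₂ =>
    obtain ⟨D₁, rfl⟩ := D₁.next_inv
    obtain ⟨D₂, rfl⟩ := D₂.next_inv
    refine ⟨.next (.app D₁ D₂), Hom.ext (funext fun i => ?_)⟩
    cases i with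
    | zero => rfl
    -- Both parts are restricted to stage `i` before the application on the left and after it on the
    -- right. An element of an exponential commutes with restriction, so the results agree.
    | succ i => exact funext fun γ => (D₁.den.app (i + 1) γ).2 i le_rfl (D₂.den.app (i + 1) γ)
  | unbox_box ts t =>
    cases D with | unbox D =>
    obtain ⟨Δ, hΔ, D, Ds, rfl⟩ := D.box_inv
    obtain ⟨D', h⟩ := D.exists_subst Ds
    refine ⟨D', Hom.ext (funext fun i => funext fun γ => ?_)⟩
    exact (congrArg (D.den.app i) (substHom_move Ds hΔ _ _)).trans
      (congrArg (fun f => Hom.app f i γ) h).symm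
  | boxPlus_subst hm ts t =>
    cases D with | boxPlus hΔ D Ds =>
    obtain ⟨D', h⟩ := D.exists_subst Ds
    refine ⟨.boxPlus constant_nil D' fun x => x.elim0, Hom.ext (funext fun i => funext fun γ => ?_)⟩
    -- Both sides split a global element, so it is enough to compare these two elements at each
    -- stage.
    refine congrArg Hom.split (Hom.ext (funext fun j => funext fun _ => ?_))
    exact (congrArg (D.den.app j) (substHom_move Ds hΔ _ _)).trans
      (congrArg (fun f => Hom.app f j _) h).symm
  | boxPlus_inl t =>
    cases D with | boxPlus hΔ D Ds =>
    obtain ⟨D, rfl⟩ := D.inl_inv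
    refine ⟨.inl (.box hΔ D Ds), Hom.ext (funext fun i => funext fun γ => ?_)⟩
    exact Hom.split_eq_inl
      (s := (Hom.box (Ctx.isConst_den hΔ) (Hom.inl D.den) (substHom Ds)).app i γ)
      fun j => rfl
  | boxPlus_inr t =>
    cases D with | boxPlus hΔ D Ds =>
    obtain ⟨D, rfl⟩ := D.inr_inv
    refine ⟨.inr (.box hΔ D Ds), Hom.ext (funext fun i => funext fun γ => ?_)⟩
    exact Hom.split_eq_inr
      (s := (Hom.box (Ctx.isConst_den hΔ) (Hom.inr D.den) (substHom Ds)).app i γ)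
      fun j => rfl

/-- The hole is never beneath a binder: in `prev E` and `box⁺ E` the explicit substitution is empty,
so the body is closed. `Sound` quantifies over all types, so it applies at whatever type the
derivation gives to the hole, and the denotation is compositional. -/
theorem Sound.plug {t u : Tm 0} (h : Sound t u) (E : ECtx) : Sound (E.plug t) (E.plug u) := by
  induction E with
  | hole => exact h
  | succ E ih =>
    intro A D
    cases D with | succ D =>
    obtain ⟨D', e⟩ := ih _ D
    exact ⟨.succ D', congrArg Hom.succ e⟩
  | fst E ih =>
    intro A D
    cases D with | fst D =>
    obtain ⟨D', e⟩ := ih _ D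
    exact ⟨.fst D', congrArg Hom.fst e⟩
  | snd E ih =>
    intro A D
    cases D with | snd D =>
    obtain ⟨D', e⟩ := ih _ D
    exact ⟨.snd D', congrArg Hom.snd e⟩
  | caseOf E t₁ t₂ ih =>
    intro A D
    cases D with | caseOf D D₁ D₂ =>
    obtain ⟨D', e⟩ := ih _ D
    exact ⟨.caseOf D' D₁ D₂, congrArg (Hom.caseOf · _ _) e⟩
  | app E s ih =>
    intro A D
    cases D with | app D D₁ =>
    obtain ⟨D', e⟩ := ih _ D
    exact ⟨.app D' D₁, congrArg (Hom.ap · _) e⟩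
  | unfold E ih =>
    intro A D
    cases D with | unfold hA D =>
    obtain ⟨D', e⟩ := ih _ D
    exact ⟨.unfold hA D', congrArg (Hom.comp · _) e⟩
  | prev E ih =>
    intro A D
    cases D with | @prev _ _ _ Δ _ _ _ hΔ D Ds =>
    obtain rfl : Δ = Ctx.nil := Subsingleton.elim _ _
    obtain ⟨D', e⟩ := ih _ D
    exact ⟨.prev hΔ D' Ds, congrArg (Hom.prev _ · _) e⟩
  | lapLeft E s ih =>
    intro A D
    cases D with | lap D D₁ =>
    obtain ⟨D', e⟩ := ih _ D
    exact ⟨.lap D' D₁, congrArg (Hom.lap · _) e⟩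
  | lapRight v hv E ih =>
    intro A D
    cases D with | lap D₁ D =>
    obtain ⟨D', e⟩ := ih _ D
    exact ⟨.lap D₁ D', congrArg (Hom.lap _ ·) e⟩
  | unbox E ih =>
    intro A D
    cases D with | unbox D =>
    obtain ⟨D', e⟩ := ih _ D
    exact ⟨.unbox D', congrArg Hom.unbox e⟩
  | boxPlus E ih =>
    intro A D
    cases D with | @boxPlus _ _ _ Δ _ _ _ _ hΔ D Ds =>
    obtain rfl : Δ = Ctx.nil := Subsingleton.elim _ _
    obtain ⟨D', e⟩ := ih _ D
    exact ⟨.boxPlus hΔ D' Ds, congrArg (Hom.boxPlus _ · _) e⟩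

theorem Step.sound {t u : Tm 0} (h : Step t u) : Sound t u := by
  cases h with | mk E h => exact h.sound.plug E

theorem Steps.sound {t u : Tm 0} (h : Steps t u) : Sound t u := by
  induction h with
  | refl => exact fun _ D => ⟨D, rfl⟩
  | tail _ h ih =>
    intro A D
    obtain ⟨D', e⟩ := ih _ D
    obtain ⟨D'', e'⟩ := h.sound _ D'
    exact ⟨D'', e.trans e'⟩

end GuardedLambda

theorem theorem2p5 {t u : Tm 0} (htu : Steps t u) {A : CTy} (D : Typing Ctx.nil t A) :
    Nonempty (Typing Ctx.nil u A) ∧ ∀ D' : Typing Ctx.nil u A, D.den = D'.den := by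
  obtain ⟨D₀, e⟩ := htu.sound _ D
  -- Soundness produces the particular derivation `D₀`; coherence replaces it by an arbitrary one.
  -- No coherence is needed for `t`, as `D` was arbitrary.
  exact ⟨⟨D₀⟩, fun D' => e.trans (D₀.den_eq D')⟩
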